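/- Let $(X,d)$ be a complete $\mathrm{CAT}(-1)$ space, i.e. a complete geodesic metric space in which any two points of a geodesic triangle are at most as far apart as the corresponding points of a comparison triangle in the hyperbolic plane $\mathbb H^2$ (of curvature $-1$). Its boundary at infinity $\partial X$ is the set of geodesic rays $[0,\infty)\to X$ modulo the relation of staying at bounded distance. It carries the cone topology: fix an origin $o\in X$ and take the quotient topology for the map sending a ray issuing from $o$ to its class, the set of such rays having the topology of uniform convergence on compact sets (the choice of $o$ is immaterial). Isometries of $X$ act on $\partial X$. The cross ratio of four distinct points $\xi_0,\eta_0,\xi_1,\eta_1\in\partial X$ is $$\mathrm{cr}_X(\xi_0,\eta_0,\xi_1,\eta_1)=\lim e^{\frac12\left(d(x_0,x_1)+d(y_0,y_1)-d(x_0,y_1)-d(x_1,y_0)\right)},$$ the limit being taken as $x_0,y_0,x_1,y_1\in X$ tend to $\xi_0,\eta_0,\xi_1,\eta_1$, respectively, along geodesic rays. Theorem. Assume that the isometry group of $X$ acts transitively on the triples of distinct points of $\partial X$. Let $\varphi_k:\partial\mathbb H^2\to\partial X$ $(k\in\mathbb N)$ be a sequence of continuous maps that is asymptotically Moebius: for all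 distinct $\xi_0,\eta_0,\xi_1,\eta_1\in\partial\mathbb H^2$ the points $\varphi_k(\xi_0),\varphi_k(\eta_0),\varphi_k(\xi_1),\varphi_k(\eta_1)$ are distinct for all large $k$ and $$\lim_{k\to\infty}\mathrm{cr}_X(\varphi_k(\xi_0),\varphi_k(\eta_0),\varphi_k(\xi_1),\varphi_k(\eta_1))=\mathrm{cr}_{\mathbb H^2}(\xi_0,\eta_0,\xi_1,\eta_1).$$ Then there are isometries $g_k$ of $X$ onto itself $(k\in\mathbb N)$ and a map $\varphi_\infty:\partial\mathbb H^2\to\partial X$ such that $\lim_{k\to\infty}g_k\varphi_k(\xi)=\varphi_\infty(\xi)$ for every $\xi\in\partial\mathbb H^2$. Moreover, $\varphi_\infty$ is induced by an isometric embedding $F:\mathbb H^2\to X$, i.e. $\varphi_\infty$ sends the class of each geodesic ray $c$ of $\mathbb H^2$ to the class of the ray $F\circ c$. -/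

import Mathlib

open Filter Topology
open scoped NNReal UpperHalfPlane

/-- `γ`, restricted to `[0, d(x,y)]`, is a geodesic segment from `x` to `y`. -/
structure IsGeodesicSegment {X : Type*} [MetricSpace X] (γ : ℝ → X) (x y : X) : Prop where
  source : γ 0 = x
  target : γ (dist x y) = y
  dist_eq : ∀ s ∈ Set.Icc 0 (dist x y), ∀ t ∈ Set.Icc 0 (dist x y),
    dist (γ s) (γ t) = |s - t|

/-- `CAT(-1)` spaces: geodesic metric spaces all of whose geodesic triangles are at least as thin as
their comparison triangles in the hyperbolic plane. The comparison is written for two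
points lying on two sides that issue from a common vertex `x`; as the vertices are arbitrary, this
covers every pair of sides (for two points of one and the same side there is nothing to
compare). -/
structure IsCATNegOne (X : Type*) [MetricSpace X] : Prop where
  exists_geodesic : ∀ x y : X, ∃ γ : ℝ → X, IsGeodesicSegment γ x y
  comparison : ∀ (x y z : X) (γ₁ γ₂ : ℝ → X),
    IsGeodesicSegment γ₁ x y → IsGeodesicSegment γ₂ x z →
    ∀ (x' y' z' : ℍ) (γ₁' γ₂' : ℝ → ℍ),
      dist x' y' = dist x y → dist y' z' = dist y z → dist x' z' = dist x z →
      IsGeodesicSegment γ₁' x' y' → IsGeodesicSegment γ₂' x' z' →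
      ∀ s ∈ Set.Icc 0 (dist x y), ∀ t ∈ Set.Icc 0 (dist x z),
        dist (γ₁ s) (γ₂ t) ≤ dist (γ₁' s) (γ₂' t)

/-- Geodesic rays `[0,∞) → X`. -/
def GeodesicRay (X : Type*) [MetricSpace X] : Type _ :=
  {c : ℝ≥0 → X // Isometry c}

namespace GeodesicRay

/-- The image of a geodesic ray under an isometric embedding. -/
def map {X Y : Type*} [MetricSpace X] [MetricSpace Y] (F : X → Y) (hF : Isometry F)
    (c : GeodesicRay X) : GeodesicRay Y :=
  ⟨F ∘ c.1, hF.comp c.2⟩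

/-- Two geodesic rays are asymptotic if they stay at bounded distance. -/
def asymptotic (X : Type*) [MetricSpace X] : Setoid (GeodesicRay X) where
  r c₀ c₁ := ∃ C : ℝ, ∀ t : ℝ≥0, dist (c₀.1 t) (c₁.1 t) < C
  iseqv :=
    { refl := fun c => ⟨1, fun t => by simp⟩
      symm := fun ⟨C, h⟩ => ⟨C, fun t => by rw [dist_comm]; exact h t⟩
      trans := fun ⟨C, h⟩ ⟨D, h'⟩ =>
        ⟨C + D, fun t => (dist_triangle _ _ _).trans_lt (add_lt_add (h t) (h' t))⟩ }

end GeodesicRay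

/-- The boundary at infinity: asymptoty classes of geodesic rays. -/
def Boundary (X : Type*) [MetricSpace X] : Type _ :=
  Quotient (GeodesicRay.asymptotic X)

/-- The endpoint `c(∞)` of a geodesic ray. -/
def GeodesicRay.endpoint {X : Type*} [MetricSpace X] (c : GeodesicRay X) : Boundary X :=
  Quotient.mk (GeodesicRay.asymptotic X) c

/-- The map between boundaries induced by an isometric embedding, `c(∞) ↦ (F ∘ c)(∞)`. -/
def Boundary.map {X Y : Type*} [MetricSpace X] [MetricSpace Y] (F : X → Y) (hF : Isometry F) :
    Boundary X → Boundary Y :=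
  Quotient.map (GeodesicRay.map F hF) (by
    rintro c₀ c₁ ⟨C, h⟩
    exact ⟨C, fun t => by simpa [GeodesicRay.map, hF.dist_eq] using h t⟩)

/-- The topology of uniform convergence on compact sets on the set of geodesic rays issuing
from `o`. -/
@[reducible] def rayTopology {X : Type*} [MetricSpace X] (o : X) :
    TopologicalSpace {c : GeodesicRay X // c.1 0 = o} :=
  TopologicalSpace.induced (fun c => (⟨c.1.1, c.1.2.continuous⟩ : C(ℝ≥0, X))) inferInstance

/-- The cone topology on the boundary at infinity, with origin `o`: the quotient topology under
the map that sends a geodesic ray issuing from `o` to its endpoint. -/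
@[reducible] def coneTopology {X : Type*} [MetricSpace X] (o : X) : TopologicalSpace (Boundary X) :=
  TopologicalSpace.coinduced (fun c : {c : GeodesicRay X // c.1 0 = o} => c.1.endpoint)
    (rayTopology o)

/-- `r` is the limit of
`exp (½ (d(x₀,x₁) + d(y₀,y₁) - d(x₀,y₁) - d(x₁,y₀)))` as `(x₀,y₀,x₁,y₁)` converges radially
(along geodesic rays) to `(ξ₀,η₀,ξ₁,η₁)`. -/
def HasCrossRatio {X : Type*} [MetricSpace X] (ξ₀ η₀ ξ₁ η₁ : Boundary X) (r : ℝ) : Prop :=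
  ∀ a₀ b₀ a₁ b₁ : GeodesicRay X,
    a₀.endpoint = ξ₀ → b₀.endpoint = η₀ → a₁.endpoint = ξ₁ → b₁.endpoint = η₁ →
    Tendsto (fun t : ℝ≥0 × ℝ≥0 × ℝ≥0 × ℝ≥0 =>
      Real.exp ((1 / 2 : ℝ) *
        (dist (a₀.1 t.1) (a₁.1 t.2.2.1) + dist (b₀.1 t.2.1) (b₁.1 t.2.2.2)
          - dist (a₀.1 t.1) (b₁.1 t.2.2.2) - dist (a₁.1 t.2.2.1) (b₀.1 t.2.1))))
      atTop (𝓝 r)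

open Classical in
/-- The cross ratio of four distinct points at infinity (the value `0` is used where the limit
does not exist; in a complete `CAT(-1)` space it exists for all distinct points). -/
noncomputable def crossRatio {X : Type*} [MetricSpace X] (ξ₀ η₀ ξ₁ η₁ : Boundary X) : ℝ :=
  if h : ∃ r, HasCrossRatio ξ₀ η₀ ξ₁ η₁ r then h.choose else 0

/-- Asymptotically Moebius sequences: for every quadruple of distinct points the cross ratios of
the image quadruples converge to the cross ratio of the quadruple. As cross ratios are taken of
distinct points, the image quadruple has to consist of distinct points from some `k` on. -/
def AsymptoticallyMoebius {X Y : Type*} [MetricSpace X] [MetricSpace Y]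
    (φ : ℕ → Boundary X → Boundary Y) : Prop :=
  ∀ ξ₀ η₀ ξ₁ η₁ : Boundary X, [ξ₀, η₀, ξ₁, η₁].Nodup →
    (∀ᶠ k in atTop, [φ k ξ₀, φ k η₀, φ k ξ₁, φ k η₁].Nodup) ∧
    Tendsto (fun k => crossRatio (φ k ξ₀) (φ k η₀) (φ k ξ₁) (φ k η₁)) atTop
      (𝓝 (crossRatio ξ₀ η₀ ξ₁ η₁))

/-- The isometry group of `X` acts transitively on triples of distinct points at infinity. -/
def TransitiveOnTriples (X : Type*) [MetricSpace X] : Prop :=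
  ∀ a b c a' b' c' : Boundary X, [a, b, c].Nodup → [a', b', c'].Nodup →
    ∃ g : X ≃ᵢ X, Boundary.map g g.isometry a = a' ∧ Boundary.map g g.isometry b = b' ∧
      Boundary.map g g.isometry c = c'

/-!
Everything is derived from one consequence of the `CAT(-1)` condition, *Stewart's inequality*: for a
point `p` of a segment from `x` to `y`,
`cosh d(z,p) sinh d(x,y) ≤ cosh d(z,x) sinh d(p,y) + cosh d(z,y) sinh d(x,p)`
(`IsCATNegOne.isStewart`), with equality in the hyperbolic plane (`stewart_upperHalfPlane`). It
yields rays from any point to any point at infinity, and geodesic lines. The boundary is studied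
through Bourdon's visual metrics `visual p ξ η = exp (-(ξ|η)_p)`: cross ratios are quotients of them
(`IsStewart.crossRatio_eq`), the line joining `ξ` and `η` is the set of `p` with `visual p ξ η = 1`,
and convergence in them implies convergence in the cone topology (`IsStewart.tendsto_cone`). The
ideal form of Stewart's inequality says that for `p` on the line from `ξ` to `η`
`visual p ξ ω ^ 2 + visual p η ω ^ 2 ≥ 1` (`IsStewart.one_le_visual_sq_add`); in the hyperbolic plane
this is `sin ^ 2 + cos ^ 2 = 1`.

*Compactness.* As `X` need not be proper, the limit map has to come from transitivity on triples.
Normalise the maps so that they fix a triple. In the hyperbolic plane the diagonals of the ideal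
quadrilateral formed by the triple and a further point `ξ` intersect, and Ptolemy's inequality is an
equality. Hence in the limit the diagonals of the image quadrilaterals intersect too, in a fixed
point `p`, so that all images of `ξ` are seen from `p` almost opposite to one point `a` of the
triple. Two sides of an ideal triangle of `X` do not meet (`visual_ne_one`): otherwise, by
transitivity, all triangles would be degenerate as in a tree, and so would be the cross ratios. By
transitivity the separation of sides is uniform, and therefore two sides that issue from `a` and
both pass near `p` have ends close to each other: the images of `ξ` form a Cauchy sequence
(`tendsto_visual_zero`).

*Rigidity.* The limit map `φ` preserves cross ratios. For a point `z` of the hyperbolic plane and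
antipodes `ξ`, `η` at `z` there is a point `q` of the line joining `φ ξ` and `φ η` for which the
visual metric at `q` pulls back to a conformal multiple of that at `z`. The conformal factor is at
least `1` by the ideal form of Stewart's inequality, and at most `1` on antipodes, as visual metrics
are bounded by `1`; so it is `1` (`exists_visual_eq`). The map `z ↦ q` is the isometric embedding
(`exists_isometry_of_moebius`).
-/

namespace CATNegOne

/-- Geodesic spaces satisfying Stewart's inequality: if `p` lies between `x` and `y`, the distance
from `z` to `p` is at most what it would be in the hyperbolic plane. -/
structure IsStewart (X : Type*) [MetricSpace X] : Prop where
  exists_geodesic : ∀ x y : X, ∃ γ : ℝ → X, IsGeodesicSegment γ x y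
  stewart : ∀ z x y p : X, dist x p + dist p y = dist x y →
    Real.cosh (dist z p) * Real.sinh (dist x y) ≤
      Real.cosh (dist z x) * Real.sinh (dist p y) + Real.cosh (dist z y) * Real.sinh (dist x p)

lemma cosh_le_cosh_of_nonneg {a b : ℝ} (hb : 0 ≤ b) (h : |a| ≤ b) :
    Real.cosh a ≤ Real.cosh b := by
  rw [Real.cosh_le_cosh, abs_of_nonneg hb]; exact h

lemma le_of_cosh_le_cosh {a b : ℝ} (ha : 0 ≤ a) (hb : 0 ≤ b) (h : Real.cosh a ≤ Real.cosh b) :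
    a ≤ b := by
  rwa [Real.cosh_le_cosh, abs_of_nonneg ha, abs_of_nonneg hb] at h

lemma eq_of_cosh_dist_le_one {X : Type*} [MetricSpace X] {x y : X}
    (h : Real.cosh (dist x y) ≤ 1) : x = y := by
  refine dist_le_zero.1 (le_of_cosh_le_cosh dist_nonneg le_rfl ?_)
  simpa using h

/-- A point of a segment satisfying Stewart's inequality is determined by its distances from the
endpoints. -/
lemma eq_of_stewart {X : Type*} [MetricSpace X] {x y p p' : X}
    (hp : dist x p + dist p y = dist x y) (h : dist x p = dist x p')
    (h' : dist p y = dist p' y)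
    (hS : Real.cosh (dist p p') * Real.sinh (dist x y) ≤
      Real.cosh (dist p x) * Real.sinh (dist p' y)
        + Real.cosh (dist p y) * Real.sinh (dist x p')) : p = p' := by
  rcases eq_or_ne x y with rfl | hxy
  · have h1 : dist x p = 0 := by
      have := dist_nonneg (x := x) (y := p)
      have := dist_nonneg (x := p) (y := x)
      simp only [dist_self] at hp; linarith
    have h2 : dist x p' = 0 := by rw [← h, h1]
    rw [← dist_eq_zero.1 h1, dist_eq_zero.1 h2]
  · have hL : 0 < Real.sinh (dist x y) := Real.sinh_pos_iff.2 (dist_pos.2 hxy)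
    apply eq_of_cosh_dist_le_one
    refine le_of_mul_le_mul_right ?_ hL
    rw [dist_comm p x, ← h, ← h'] at hS
    refine hS.trans (le_of_eq ?_)
    rw [one_mul, ← hp, Real.sinh_add]; ring

lemma _root_.IsGeodesicSegment.dist_left_right {X : Type*} [MetricSpace X] {x y : X} {γ : ℝ → X}
    (hγ : IsGeodesicSegment γ x y) {s : ℝ} (hs : s ∈ Set.Icc 0 (dist x y)) :
    dist x (γ s) = s ∧ dist (γ s) y = dist x y - s := by
  have h1 := hγ.dist_eq 0 ⟨le_rfl, dist_nonneg⟩ s hs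
  have h2 := hγ.dist_eq s hs _ ⟨dist_nonneg, le_rfl⟩
  rw [hγ.source, zero_sub, abs_neg, abs_of_nonneg hs.1] at h1
  rw [hγ.target, abs_sub_comm, abs_of_nonneg (by linarith [hs.2])] at h2
  exact ⟨h1, h2⟩

/-! ### The hyperboloid model of the hyperbolic plane -/

/-- The Lorentzian form on `ℝ³`, in coordinates for which a vector `(A, B, C)` stands for the
symmetric matrix with rows `(A, B)` and `(B, C)`; the quadratic form is the determinant. -/
noncomputable def lor (u v : ℝ × ℝ × ℝ) : ℝ := (u.1 * v.2.2 + u.2.2 * v.1) / 2 - u.2.1 * v.2.1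

/-- The point of the hyperboloid `lor u u = 1` that represents a point of the upper half-plane. -/
noncomputable def vec (z : ℍ) : ℝ × ℝ × ℝ :=
  (1 / z.im, z.re / z.im, (z.re ^ 2 + z.im ^ 2) / z.im)

lemma lor_comm (u v : ℝ × ℝ × ℝ) : lor u v = lor v u := by simp only [lor]; ring

lemma lor_add_left (u v w : ℝ × ℝ × ℝ) : lor (u + v) w = lor u w + lor v w := by
  simp only [lor, Prod.fst_add, Prod.snd_add]; ring

lemma lor_smul_left (c : ℝ) (v w : ℝ × ℝ × ℝ) : lor (c • v) w = c * lor v w := by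
  simp only [lor, Prod.smul_fst, Prod.smul_snd, smul_eq_mul]; ring

lemma lor_add_right (u v w : ℝ × ℝ × ℝ) : lor w (u + v) = lor w u + lor w v := by
  rw [lor_comm, lor_add_left, lor_comm u, lor_comm v]

lemma lor_smul_right (c : ℝ) (v w : ℝ × ℝ × ℝ) : lor w (c • v) = c * lor w v := by
  rw [lor_comm, lor_smul_left, lor_comm v]

lemma lor_vec (z w : ℍ) : lor (vec z) (vec w) = Real.cosh (dist z w) := by
  have hz := z.im_ne_zero
  have hw := w.im_ne_zero
  rw [UpperHalfPlane.cosh_dist, Complex.dist_eq, Complex.sq_norm, Complex.normSq_apply]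
  simp only [lor, vec, Complex.sub_re, Complex.sub_im, UpperHalfPlane.coe_re,
    UpperHalfPlane.coe_im]
  field_simp
  ring

lemma lor_vec_self (z : ℍ) : lor (vec z) (vec z) = 1 := by simp [lor_vec]

lemma vec_fst_pos (z : ℍ) : 0 < (vec z).1 := one_div_pos.2 z.im_pos

lemma vec_injective : Function.Injective vec := fun z w h => by
  apply eq_of_cosh_dist_le_one
  rw [← lor_vec, h, lor_vec_self]

lemma exists_vec_eq {u : ℝ × ℝ × ℝ} (h : lor u u = 1) (h0 : 0 < u.1) : ∃ z, vec z = u := by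
  obtain ⟨A, B, C⟩ := u
  simp only [lor] at h h0
  refine ⟨⟨⟨B / A, 1 / A⟩, by simpa using h0⟩, ?_⟩
  have hA := h0.ne'
  simp only [vec, UpperHalfPlane.re, UpperHalfPlane.im, Prod.mk.injEq]
  refine ⟨by field_simp, by field_simp, ?_⟩
  field_simp
  linarith

lemma sinh_add_sq (a b : ℝ) : Real.sinh (a + b) ^ 2 =
    Real.sinh a ^ 2 + Real.sinh b ^ 2 + 2 * Real.sinh a * Real.sinh b * Real.cosh (a + b) := by
  have h1 := Real.cosh_sq a
  have h2 := Real.cosh_sq b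
  rw [Real.sinh_add, Real.cosh_add]
  linear_combination (-(Real.sinh b ^ 2)) * h1 + (-(Real.sinh a ^ 2)) * h2 +
    2 * Real.sinh b ^ 2 * h1 + 2 * Real.sinh a ^ 2 * h2

/-- The point at distance `s` from `x` on the segment from `x` to `y`. -/
lemma exists_vec_segment {x y : ℍ} (hxy : x ≠ y) {s : ℝ} (hs : s ∈ Set.Icc 0 (dist x y)) :
    ∃ p : ℍ, vec p = (Real.sinh (dist x y - s) / Real.sinh (dist x y)) • vec x
      + (Real.sinh s / Real.sinh (dist x y)) • vec y := by
  have hL : 0 < dist x y := dist_pos.2 hxy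
  have hS : 0 < Real.sinh (dist x y) := Real.sinh_pos_iff.2 hL
  have h1 : 0 ≤ Real.sinh s := Real.sinh_nonneg_iff.2 hs.1
  have h2 : 0 ≤ Real.sinh (dist x y - s) := Real.sinh_nonneg_iff.2 (by linarith [hs.2])
  apply exists_vec_eq
  · simp only [lor_add_left, lor_add_right, lor_smul_left, lor_smul_right, lor_vec, dist_self,
      Real.cosh_zero, dist_comm y x]
    have := sinh_add_sq (dist x y - s) s
    rw [sub_add_cancel] at this
    field_simp
    linarith
  · have hx := vec_fst_pos x
    have hy := vec_fst_pos y
    simp only [Prod.fst_add, Prod.smul_fst, smul_eq_mul]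
    rcases hs.1.eq_or_lt with h | h
    · rw [← h]; simp only [sub_zero, Real.sinh_zero, zero_div, zero_mul, add_zero]
      rw [div_self hS.ne']; simpa
    · have : 0 < Real.sinh s := Real.sinh_pos_iff.2 h
      positivity

lemma exists_geodesicSegment_upperHalfPlane (x y : ℍ) :
    ∃ γ : ℝ → ℍ, IsGeodesicSegment γ x y ∧ ∀ s ∈ Set.Icc 0 (dist x y), ∀ z,
      Real.cosh (dist z (γ s)) * Real.sinh (dist x y) =
      Real.cosh (dist z x) * Real.sinh (dist x y - s) + Real.cosh (dist z y) * Real.sinh s := by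
  rcases eq_or_ne x y with rfl | hxy
  · refine ⟨fun _ => x, ⟨rfl, rfl, ?_⟩, ?_⟩
    · simp only [dist_self, Set.Icc_self, Set.mem_singleton_iff]
      rintro s rfl t rfl; simp
    · simp only [dist_self, Set.Icc_self, Set.mem_singleton_iff]
      rintro s rfl z; simp
  · have hL : 0 < dist x y := dist_pos.2 hxy
    have hS : 0 < Real.sinh (dist x y) := Real.sinh_pos_iff.2 hL
    have key : ∀ s : ℝ, ∃ p : ℍ, s ∈ Set.Icc 0 (dist x y) →
        vec p = (Real.sinh (dist x y - s) / Real.sinh (dist x y)) • vec x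
      + (Real.sinh s / Real.sinh (dist x y)) • vec y := fun s => by
      by_cases hs : s ∈ Set.Icc 0 (dist x y)
      · obtain ⟨p, hp⟩ := exists_vec_segment hxy hs
        exact ⟨p, fun _ => hp⟩
      · exact ⟨x, fun h => absurd h hs⟩
    choose γ hγ using key
    refine ⟨γ, ⟨?_, ?_, ?_⟩, ?_⟩
    · apply vec_injective
      rw [hγ 0 ⟨le_rfl, hL.le⟩]
      simp [div_self hS.ne']
    · apply vec_injective
      rw [hγ _ ⟨hL.le, le_rfl⟩]
      simp [div_self hS.ne']
    · intro s hs t ht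
      have : Real.cosh (dist (γ s) (γ t)) = Real.cosh (s - t) := by
        rw [← lor_vec, hγ s hs, hγ t ht]
        simp only [lor_add_left, lor_add_right, lor_smul_left, lor_smul_right, lor_vec, dist_self,
          Real.cosh_zero, dist_comm y x]
        have hc := Real.cosh_sq (dist x y)
        rw [Real.sinh_sub, Real.sinh_sub, Real.cosh_sub]
        field_simp
        linear_combination (-(Real.sinh s * Real.sinh t)) * hc
      rw [← Real.cosh_abs (s - t)] at this
      exact le_antisymm (le_of_cosh_le_cosh dist_nonneg (abs_nonneg _) this.le)
        (le_of_cosh_le_cosh (abs_nonneg _) dist_nonneg this.ge)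
    · intro s hs z
      rw [← lor_vec, hγ s hs]
      simp only [lor_add_right, lor_smul_right, lor_vec]
      field_simp

/-- Stewart's theorem in the hyperbolic plane. -/
lemma stewart_upperHalfPlane (z x y p : ℍ) (hp : dist x p + dist p y = dist x y) :
    Real.cosh (dist z p) * Real.sinh (dist x y) =
      Real.cosh (dist z x) * Real.sinh (dist p y) + Real.cosh (dist z y) * Real.sinh (dist x p) := by
  obtain ⟨γ, hγ, h⟩ := exists_geodesicSegment_upperHalfPlane x y
  have hs : dist x p ∈ Set.Icc 0 (dist x y) := ⟨dist_nonneg, by linarith [dist_nonneg (x := p) (y := y)]⟩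
  obtain ⟨e1, e2⟩ := hγ.dist_left_right hs
  replace e2 : dist (γ (dist x p)) y = dist p y := by linarith
  have e3 : p = γ (dist x p) := by
    refine eq_of_stewart hp e1.symm e2.symm ?_
    rw [h _ hs, e1, e2, ← hp]; simp
  have := h _ hs z
  rw [← e3] at this
  rw [this, ← hp]; simp

lemma isStewart_upperHalfPlane : IsStewart ℍ where
  exists_geodesic x y :=
    let ⟨γ, hγ, _⟩ := exists_geodesicSegment_upperHalfPlane x y
    ⟨γ, hγ⟩
  stewart z x y p hp := (stewart_upperHalfPlane z x y p hp).le

/-- Comparison triangles exist in the hyperbolic plane. -/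
lemma exists_comparison_triangle {a b L : ℝ} (hL : 0 < L) (ha : 0 ≤ a) (hb : 0 ≤ b)
    (h1 : a ≤ L + b) (h2 : b ≤ a + L) (h3 : L ≤ a + b) :
    ∃ x y z : ℍ, dist x y = L ∧ dist x z = a ∧ dist y z = b := by
  have hS : 0 < Real.sinh L := Real.sinh_pos_iff.2 hL
  have hcs : Real.cosh L ^ 2 = Real.sinh L ^ 2 + 1 := Real.cosh_sq L
  have hem : Real.cosh L - Real.sinh L = Real.exp (-L) := Real.cosh_sub_sinh L
  obtain ⟨x, hx⟩ := exists_vec_eq (u := (1, 0, 1)) (by norm_num [lor]) (by norm_num)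
  obtain ⟨y, hy⟩ := exists_vec_eq
    (u := (Real.cosh L - Real.sinh L, 0, Real.cosh L + Real.sinh L))
    (by simp only [lor]; linear_combination hcs) (by simp only [hem]; positivity)
  -- The third vertex has coordinates `(A, B, C)` with `A`, `C` determined by two linear equations.
  set α := Real.cosh a
  set β := Real.cosh b
  set A := (β - (Real.cosh L - Real.sinh L) * α) / Real.sinh L with hA
  set C := ((Real.cosh L + Real.sinh L) * α - β) / Real.sinh L with hC
  have hAC : 1 ≤ A * C := by
    have k1 : β ≤ Real.cosh (a + L) := cosh_le_cosh_of_nonneg (by linarith)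
      (by rw [abs_of_nonneg hb]; exact h2)
    have k2 : Real.cosh (a - L) ≤ β := cosh_le_cosh_of_nonneg hb
      (by rw [abs_le]; constructor <;> linarith)
    rw [Real.cosh_add] at k1
    rw [Real.cosh_sub] at k2
    have k3 := mul_nonneg (sub_nonneg.2 k1) (sub_nonneg.2 k2)
    have has := Real.cosh_sq a
    rw [hA, hC, div_mul_div_comm, le_div_iff₀ (by positivity)]
    have has' : Real.sinh a ^ 2 = α ^ 2 - 1 := by linarith
    nlinarith
  have hsum : A + C = 2 * α := by rw [hA, hC]; field_simp; ring
  have hA0 : 0 < A := by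
    have : 1 ≤ α := Real.one_le_cosh a
    by_contra! hneg
    rcases le_or_gt 0 C with h | h
    · nlinarith
    · linarith
  obtain ⟨z, hz⟩ := exists_vec_eq (u := (A, √(A * C - 1), C))
    (by simp only [lor]; nlinarith [Real.mul_self_sqrt (sub_nonneg.2 hAC)]) hA0
  have hd : ∀ {u v : ℍ} {r : ℝ}, 0 ≤ r → lor (vec u) (vec v) = Real.cosh r → dist u v = r := by
    intro u v r hr h
    rw [lor_vec] at h
    exact le_antisymm (le_of_cosh_le_cosh dist_nonneg hr h.le)
      (le_of_cosh_le_cosh hr dist_nonneg h.ge)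
  refine ⟨x, y, z, hd hL.le ?_, hd ha ?_, hd hb ?_⟩
  · rw [hx, hy]; simp only [lor]; ring
  · rw [hx, hz]; simp only [lor]; linarith
  · rw [hy, hz]; simp only [lor]; rw [hA, hC]; field_simp; ring

/-- Stewart's inequality is the comparison of a vertex with a point of the opposite side. -/
theorem _root_.IsCATNegOne.isStewart {X : Type*} [MetricSpace X] (hX : IsCATNegOne X) :
    IsStewart X := by
  have key : ∀ (x y z : X) (γ : ℝ → X), IsGeodesicSegment γ x y → ∀ s ∈ Set.Icc 0 (dist x y),
      Real.cosh (dist z (γ s)) * Real.sinh (dist x y) ≤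
      Real.cosh (dist z x) * Real.sinh (dist x y - s) + Real.cosh (dist z y) * Real.sinh s := by
    intro x y z γ hγ s hs
    rcases eq_or_ne x y with rfl | hxy
    · simp only [dist_self, Set.Icc_self, Set.mem_singleton_iff] at hs ⊢
      subst hs; simp
    have hL : 0 < dist x y := dist_pos.2 hxy
    have hS : 0 < Real.sinh (dist x y) := Real.sinh_pos_iff.2 hL
    obtain ⟨x', y', z', e1, e2, e3⟩ := exists_comparison_triangle hL (dist_nonneg (x := x) (y := z))
      (dist_nonneg (x := y) (y := z)) (dist_triangle x y z)
      (by rw [dist_comm x z, add_comm]; linarith [dist_triangle y x z, dist_comm x y, dist_comm x z])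
      (by rw [dist_comm y z]; exact dist_triangle x z y)
    obtain ⟨γ₂, hγ₂⟩ := hX.exists_geodesic x z
    obtain ⟨γ₁', hγ₁', hSt⟩ := exists_geodesicSegment_upperHalfPlane x' y'
    obtain ⟨γ₂', hγ₂', -⟩ := exists_geodesicSegment_upperHalfPlane x' z'
    have := hX.comparison x y z γ γ₂ hγ hγ₂ x' y' z' γ₁' γ₂' e1 e3 e2 hγ₁' hγ₂' s hs
      (dist x z) ⟨dist_nonneg, le_rfl⟩
    rw [hγ₂.target, ← e2, hγ₂'.target, dist_comm, dist_comm _ z'] at this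
    have h2 := hSt s (by rwa [e1]) z'
    rw [e1, dist_comm z' x', dist_comm z' y', e2, e3] at h2
    rw [dist_comm z x, dist_comm z y, ← h2]
    exact mul_le_mul_of_nonneg_right (cosh_le_cosh_of_nonneg dist_nonneg
      (by rwa [abs_of_nonneg dist_nonneg])) hS.le
  refine ⟨hX.exists_geodesic, fun z x y p hp => ?_⟩
  · obtain ⟨γ, hγ⟩ := hX.exists_geodesic x y
    have hs : dist x p ∈ Set.Icc 0 (dist x y) :=
      ⟨dist_nonneg, by linarith [dist_nonneg (x := p) (y := y)]⟩
    obtain ⟨d1, d2⟩ := hγ.dist_left_right hs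
    have d3 : dist x y - dist x p = dist p y := by linarith
    have e : p = γ (dist x p) := by
      refine eq_of_stewart hp d1.symm (by rw [d2, d3]) ?_
      rw [d2, d1]; exact key x y p γ hγ _ hs
    have := key x y z γ hγ _ hs
    rwa [← e, d3] at this

section Stewart

variable {X : Type*} [MetricSpace X]

/-! ### Thin triangles -/

/-- A point `z` that is almost as close to the endpoints of a segment as a point `p` of the segment
is itself close to `p`. All limits of segments are obtained from this estimate. -/
lemma IsStewart.cosh_dist_le_exp (hX : IsStewart X) {x y p z : X} {ε : ℝ}
    (hp : dist x p + dist p y = dist x y) (hε : 0 ≤ ε) (hx : dist z x ≤ dist x p + ε)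
    (hy : dist z y ≤ dist p y + ε) : Real.cosh (dist z p) ≤ Real.exp ε := by
  have hcosh : ∀ a : ℝ, 0 ≤ a → Real.cosh (a + ε) ≤ Real.cosh a * Real.exp ε := fun a ha => by
    rw [Real.cosh_add, ← Real.cosh_add_sinh ε]
    have h1 : 0 ≤ Real.sinh ε := Real.sinh_nonneg_iff.2 hε
    have h2 : Real.sinh a ≤ Real.cosh a := by
      have := Real.cosh_sub_sinh a
      linarith [Real.exp_pos (-a)]
    nlinarith
  rcases eq_or_ne x y with rfl | hxy
  · have : dist x p = 0 := by
      have := dist_nonneg (x := x) (y := p)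
      have := dist_nonneg (x := p) (y := x)
      simp only [dist_self] at hp; linarith
    obtain rfl := dist_eq_zero.1 this
    rw [dist_self, zero_add] at hx
    have := hcosh 0 le_rfl
    rw [zero_add, Real.cosh_zero, one_mul] at this
    exact (cosh_le_cosh_of_nonneg hε (by rwa [abs_of_nonneg dist_nonneg])).trans this
  · have hS : 0 < Real.sinh (dist x y) := Real.sinh_pos_iff.2 (dist_pos.2 hxy)
    have a0 : 0 ≤ dist x p := dist_nonneg
    have b0 : 0 ≤ dist p y := dist_nonneg
    have sa : 0 ≤ Real.sinh (dist x p) := Real.sinh_nonneg_iff.2 a0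
    have sb : 0 ≤ Real.sinh (dist p y) := Real.sinh_nonneg_iff.2 b0
    have h1 : Real.cosh (dist z x) ≤ Real.cosh (dist x p) * Real.exp ε :=
      (cosh_le_cosh_of_nonneg (by linarith) (by rwa [abs_of_nonneg dist_nonneg])).trans
        (hcosh _ a0)
    have h2 : Real.cosh (dist z y) ≤ Real.cosh (dist p y) * Real.exp ε :=
      (cosh_le_cosh_of_nonneg (by linarith) (by rwa [abs_of_nonneg dist_nonneg])).trans
        (hcosh _ b0)
    refine le_of_mul_le_mul_right ((hX.stewart z x y p hp).trans ?_) hS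
    have : Real.sinh (dist x y) = Real.sinh (dist x p) * Real.cosh (dist p y) +
      Real.cosh (dist x p) * Real.sinh (dist p y) := by rw [← hp, Real.sinh_add]
    rw [this]
    nlinarith [mul_le_mul_of_nonneg_right h1 sb, mul_le_mul_of_nonneg_right h2 sa]

/-- Points at the same distance `u` from the vertex `x` on two sides of a triangle are at most as
far apart as in the hyperbolic plane. -/
lemma IsStewart.cosh_dist_sub_one_le (hX : IsStewart X) {x y₁ y₂ p₁ p₂ : X} {u : ℝ}
    (h₁ : dist x p₁ + dist p₁ y₁ = dist x y₁) (h₂ : dist x p₂ + dist p₂ y₂ = dist x y₂)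
    (hu₁ : dist x p₁ = u) (hu₂ : dist x p₂ = u) :
    (Real.cosh (dist p₁ p₂) - 1) * (Real.sinh (dist x y₁) * Real.sinh (dist x y₂)) ≤
      (Real.cosh (dist y₁ y₂) - Real.cosh (dist x y₁ - dist x y₂)) * Real.sinh u ^ 2 := by
  have S₁ := hX.stewart p₂ x y₁ p₁ h₁
  have S₂ := hX.stewart y₁ x y₂ p₂ h₂
  rw [hu₁, dist_comm p₂ x, hu₂, dist_comm p₂ p₁, dist_comm p₂ y₁,
    show dist p₁ y₁ = dist x y₁ - u by linarith] at S₁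
  rw [hu₂, dist_comm y₁ x, show dist p₂ y₂ = dist x y₂ - u by linarith] at S₂
  have hu : 0 ≤ Real.sinh u := Real.sinh_nonneg_iff.2 (hu₁ ▸ dist_nonneg)
  have hL : 0 ≤ Real.sinh (dist x y₂) := Real.sinh_nonneg_iff.2 dist_nonneg
  have k1 := mul_le_mul_of_nonneg_right S₁ hL
  have k2 := mul_le_mul_of_nonneg_right S₂ hu
  have hc := Real.cosh_sq u
  rw [Real.sinh_sub] at k1 k2
  rw [Real.cosh_sub]
  set s₁ := Real.sinh (dist x y₁)
  set s₂ := Real.sinh (dist x y₂)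
  have e : Real.cosh u ^ 2 * (s₁ * s₂) = (Real.sinh u ^ 2 + 1) * (s₁ * s₂) := by rw [hc]
  nlinarith

lemma tendsto_zero_of_cosh_le {ι : Type*} {l : Filter ι} {f g : ι → ℝ}
    (hfg : ∀ᶠ i in l, Real.cosh (f i) ≤ g i) (hg : Tendsto g l (𝓝 1)) : Tendsto f l (𝓝 0) := by
  rw [Metric.tendsto_nhds]
  intro ε hε
  filter_upwards [hfg, hg.eventually_lt_const (Real.one_lt_cosh.2 hε.ne')] with i h1 h2
  rw [Real.dist_eq, sub_zero, ← abs_of_pos hε]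
  exact Real.cosh_lt_cosh.1 (h1.trans_lt h2)

lemma tendsto_of_cosh_dist_le_exp [CompleteSpace X] {f : ℝ → X} {h : ℝ → ℝ} {l t₀ : ℝ}
    (hl : Tendsto h atTop (𝓝 l))
    (hf : ∀ t s, t₀ ≤ t → t ≤ s → Real.cosh (dist (f t) (f s)) ≤ Real.exp (h t - h s)) :
    ∃ x, Tendsto f atTop (𝓝 x) := by
  apply cauchySeq_tendsto_of_complete
  refine Metric.cauchySeq_iff'.2 fun ε hε => ?_
  have h1 : 1 < Real.cosh ε := Real.one_lt_cosh.2 hε.ne'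
  obtain ⟨N, hN⟩ := Metric.cauchySeq_iff.1 hl.cauchySeq _ (Real.log_pos h1)
  refine ⟨max N t₀, fun n hn => ?_⟩
  have h2 := hN (max N t₀) (le_max_left _ _) n (le_of_max_le_left hn)
  have h3 := hf (max N t₀) n (le_max_right _ _) hn
  rw [dist_comm, ← abs_of_nonneg (dist_nonneg (x := f (max N t₀))), ← abs_of_pos hε]
  refine Real.cosh_lt_cosh.1 (h3.trans_lt ?_)
  rw [Real.dist_eq] at h2
  rw [← Real.lt_log_iff_exp_lt (by linarith)]
  exact (le_abs_self _).trans_lt h2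

/-! ### Rays and Busemann functions -/

/-- A geodesic ray as a function of a real parameter (constant for negative parameters). -/
def _root_.GeodesicRay.eval (c : GeodesicRay X) (t : ℝ) : X := c.1 t.toNNReal

@[simp] lemma eval_coe (c : GeodesicRay X) (t : ℝ≥0) : c.eval t = c.1 t := by
  simp [GeodesicRay.eval]

@[simp] lemma eval_zero (c : GeodesicRay X) : c.eval 0 = c.1 0 := by
  simp [GeodesicRay.eval]

lemma dist_eval (c : GeodesicRay X) {s t : ℝ} (hs : 0 ≤ s) (ht : 0 ≤ t) :
    dist (c.eval s) (c.eval t) = |s - t| := by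
  rw [GeodesicRay.eval, GeodesicRay.eval, c.2.dist_eq, NNReal.dist_eq, Real.coe_toNNReal s hs,
    Real.coe_toNNReal t ht]

lemma dist_eval_le (c : GeodesicRay X) {s t : ℝ} (h : s ≤ t) :
    dist (c.eval s) (c.eval t) ≤ t - s := by
  rw [GeodesicRay.eval, GeodesicRay.eval, c.2.dist_eq, NNReal.dist_eq, Real.coe_toNNReal',
    Real.coe_toNNReal', abs_sub_comm]
  exact (abs_max_sub_max_le_abs t s 0).trans_eq (abs_of_nonneg (sub_nonneg.2 h))

lemma le_dist_eval (c : GeodesicRay X) (p : X) (t : ℝ) :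
    t - dist p (c.1 0) ≤ dist p (c.eval t) := by
  rcases le_or_gt 0 t with h | h
  · have h1 := dist_eval c h le_rfl
    rw [sub_zero, abs_of_nonneg h, eval_zero] at h1
    have := dist_triangle_left (c.eval t) (c.1 0) p
    linarith
  · linarith [dist_nonneg (x := p) (y := c.eval t), dist_nonneg (x := p) (y := c.1 0)]

/-- The Busemann function of a geodesic ray, `p ↦ lim (d(p, c(t)) - t)`. -/
noncomputable def busemann (c : GeodesicRay X) (p : X) : ℝ := ⨅ t : ℝ, (dist p (c.eval t) - t)

lemma antitone_dist_eval_sub (c : GeodesicRay X) (p : X) :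
    Antitone fun t : ℝ => dist p (c.eval t) - t := fun s t h => by
  have := dist_triangle p (c.eval s) (c.eval t)
  have := dist_eval_le c h
  simp only
  linarith

lemma bddBelow_dist_eval_sub (c : GeodesicRay X) (p : X) :
    BddBelow (Set.range fun t : ℝ => dist p (c.eval t) - t) := by
  refine ⟨-dist p (c.1 0), ?_⟩
  rintro _ ⟨t, rfl⟩
  linarith [le_dist_eval c p t]

lemma tendsto_busemann (c : GeodesicRay X) (p : X) :
    Tendsto (fun t => dist p (c.eval t) - t) atTop (𝓝 (busemann c p)) :=
  tendsto_atTop_ciInf (antitone_dist_eval_sub c p) (bddBelow_dist_eval_sub c p)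

lemma busemann_le (c : GeodesicRay X) (p : X) (t : ℝ) : busemann c p ≤ dist p (c.eval t) - t :=
  ciInf_le (bddBelow_dist_eval_sub c p) t

lemma busemann_le_add (c : GeodesicRay X) (p q : X) :
    busemann c p ≤ busemann c q + dist p q := by
  refine le_of_tendsto_of_tendsto' (tendsto_busemann c p)
    ((tendsto_busemann c q).add_const (dist p q)) fun t => ?_
  linarith [dist_triangle p q (c.eval t)]

@[simp] lemma busemann_zero (c : GeodesicRay X) : busemann c (c.1 0) = 0 := by
  refine tendsto_nhds_unique (tendsto_busemann c _) ?_
  refine tendsto_const_nhds.congr' ?_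
  filter_upwards [eventually_ge_atTop 0] with t ht
  rw [← eval_zero, dist_eval c le_rfl ht]; simp [abs_of_nonneg ht]

/-- The `λ`-length of a pair of rays, `lim exp (½ (d(a(t), b(s)) - t - s))`: half the distance of
the horospheres through the origins of the rays, exponentiated. It vanishes when the rays are
asymptotic. -/
noncomputable def lambdaLength (a b : GeodesicRay X) : ℝ :=
  ⨅ ts : ℝ × ℝ, Real.exp ((dist (a.eval ts.1) (b.eval ts.2) - ts.1 - ts.2) / 2)

lemma bddBelow_lambdaLength (a b : GeodesicRay X) : BddBelow (Set.range fun ts : ℝ × ℝ =>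
    Real.exp ((dist (a.eval ts.1) (b.eval ts.2) - ts.1 - ts.2) / 2)) :=
  ⟨0, by rintro _ ⟨ts, rfl⟩; positivity⟩

lemma tendsto_lambdaLength (a b : GeodesicRay X) : Tendsto (fun ts : ℝ × ℝ =>
    Real.exp ((dist (a.eval ts.1) (b.eval ts.2) - ts.1 - ts.2) / 2)) atTop
      (𝓝 (lambdaLength a b)) := by
  refine tendsto_atTop_ciInf (fun x y h => ?_) (bddBelow_lambdaLength a b)
  simp only [Real.exp_le_exp]
  have h1 := dist_eval_le a h.1
  have h2 := dist_eval_le b h.2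
  have := dist_triangle4_right (a.eval y.1) (b.eval y.2) (a.eval x.1) (b.eval x.2)
  rw [dist_comm (a.eval y.1) (a.eval x.1), dist_comm (b.eval y.2) (b.eval x.2)] at this
  linarith

lemma lambdaLength_le (a b : GeodesicRay X) (t s : ℝ) :
    lambdaLength a b ≤ Real.exp ((dist (a.eval t) (b.eval s) - t - s) / 2) :=
  ciInf_le (bddBelow_lambdaLength a b) (t, s)

lemma lambdaLength_nonneg (a b : GeodesicRay X) : 0 ≤ lambdaLength a b :=
  le_ciInf fun _ => (Real.exp_pos _).le

/-- The `λ`-length as a limit along two curves of parameters. -/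
lemma tendsto_lambdaLength_comp (a b : GeodesicRay X) {f g : ℝ → ℝ} (hf : Tendsto f atTop atTop)
    (hg : Tendsto g atTop atTop) : Tendsto (fun t =>
    Real.exp ((dist (a.eval (f t)) (b.eval (g t)) - f t - g t) / 2)) atTop
      (𝓝 (lambdaLength a b)) := by
  have := (tendsto_lambdaLength a b).comp
    (show Tendsto (fun t => (f t, g t)) atTop atTop by
      rw [← prod_atTop_atTop_eq]; exact hf.prodMk hg)
  exact this

lemma lambdaLength_self (a : GeodesicRay X) : lambdaLength a a = 0 := by
  refine tendsto_nhds_unique (tendsto_lambdaLength_comp a a tendsto_id tendsto_id) ?_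
  simp only [id, dist_self, zero_sub]
  refine Real.tendsto_exp_atBot.comp ?_
  have : Tendsto (fun t : ℝ => -t) atTop atBot := tendsto_neg_atTop_atBot
  refine this.congr fun t => ?_
  ring

lemma lambdaLength_comm (a b : GeodesicRay X) : lambdaLength a b = lambdaLength b a := by
  refine tendsto_nhds_unique (tendsto_lambdaLength_comp a b tendsto_id tendsto_id) ?_
  refine (tendsto_lambdaLength_comp b a tendsto_id tendsto_id).congr fun t => ?_
  rw [dist_comm]

/-- Half the sum of two Busemann functions dominates half the distance of the horospheres. -/
lemma lambdaLength_le_exp_busemann (a b : GeodesicRay X) (p : X) :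
    lambdaLength a b ≤ Real.exp ((busemann a p + busemann b p) / 2) := by
  have h := (Real.continuous_exp.tendsto _).comp
    (((tendsto_busemann a p).add (tendsto_busemann b p)).div_const 2)
  refine ge_of_tendsto' h fun t => (lambdaLength_le a b t t).trans ?_
  simp only [Function.comp_apply, Real.exp_le_exp]
  linarith [dist_triangle_left (a.eval t) (b.eval t) p]

/-! ### Asymptotic rays -/

lemma endpoint_eq_iff {a b : GeodesicRay X} :
    a.endpoint = b.endpoint ↔ ∃ C : ℝ, ∀ t : ℝ≥0, dist (a.1 t) (b.1 t) < C :=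
  Quotient.eq (r := GeodesicRay.asymptotic X)

lemma endpoint_eq_of_tendsto {a b : GeodesicRay X} {κ : ℝ}
    (h : Tendsto (fun t => dist (a.eval t) (b.eval (t + κ))) atTop (𝓝 0)) :
    a.endpoint = b.endpoint := by
  obtain ⟨T, hT⟩ := eventually_atTop.1 (h.eventually_lt_const one_pos)
  rw [endpoint_eq_iff]
  refine ⟨1 + |κ| + 2 * |T| + dist (a.1 0) (b.1 0), fun t => ?_⟩
  rw [← eval_coe, ← eval_coe]
  have d0 := dist_nonneg (x := a.1 0) (y := b.1 0)
  rcases le_or_gt T t with ht | ht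
  · have h1 := hT t ht
    have h2 : dist (b.eval (t + κ)) (b.eval t) ≤ |κ| := by
      rcases le_total 0 κ with hκ | hκ
      · rw [dist_comm, abs_of_nonneg hκ]
        exact (dist_eval_le b (by linarith)).trans (by linarith)
      · rw [abs_of_nonpos hκ]
        exact (dist_eval_le b (by linarith)).trans (by linarith)
    have := dist_triangle (a.eval t) (b.eval (t + κ)) (b.eval t)
    linarith [abs_nonneg T]
  · have h1 := dist_eval_le a t.2
    have h2 := dist_eval_le b t.2
    rw [eval_zero, sub_zero] at h1 h2
    have := dist_triangle4 (a.eval t) (a.1 0) (b.1 0) (b.eval t)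
    rw [dist_comm (a.eval t) (a.1 0)] at this
    have h3 : (t : ℝ) < |T| := ht.trans_le (le_abs_self T)
    change dist _ (a.eval (t : ℝ)) ≤ (t : ℝ) at h1
    change dist _ (b.eval (t : ℝ)) ≤ (t : ℝ) at h2
    linarith [abs_nonneg κ]

lemma sinh_sub_le_exp_mul_sinh {t T : ℝ} (ht : 0 ≤ t) :
    Real.sinh (T - t) ≤ Real.exp (-t) * Real.sinh T := by
  rw [Real.sinh_eq, Real.sinh_eq]
  have h1 : Real.exp (T - t) = Real.exp (-t) * Real.exp T := by rw [← Real.exp_add]; ring_nf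
  have h2 : Real.exp (-t) * Real.exp (-T) ≤ Real.exp (-(T - t)) := by
    rw [← Real.exp_add, Real.exp_le_exp]; linarith
  linarith

lemma tendsto_exp_neg_two_mul : Tendsto (fun t : ℝ => Real.exp (-(2 * t))) atTop (𝓝 0) :=
  Real.tendsto_exp_neg_atTop_nhds_zero.comp (tendsto_id.const_mul_atTop two_pos)

lemma tendsto_cosh_dist_div_sinh_sq (a b : GeodesicRay X) :
    Tendsto (fun t => (Real.cosh (dist (a.eval t) (b.eval t)) - 1) / Real.sinh t ^ 2) atTop
      (𝓝 (2 * lambdaLength a b ^ 2)) := by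
  have h1 := (tendsto_lambdaLength_comp a b tendsto_id tendsto_id).pow 2
  have h2 : Tendsto (fun t : ℝ => Real.exp (-(dist (a.eval t) (b.eval t)) - 2 * t)) atTop (𝓝 0) :=
    squeeze_zero (fun _ => (Real.exp_pos _).le)
      (fun t => Real.exp_le_exp.2 (by linarith [dist_nonneg (x := a.eval t) (y := b.eval t)]))
      tendsto_exp_neg_two_mul
  have h3 := (((h1.add h2).div_const 2).sub tendsto_exp_neg_two_mul).div
    (((tendsto_exp_neg_two_mul.const_sub 1).pow 2).div_const 4) (by norm_num)
  have e : ((lambdaLength a b ^ 2 + 0) / 2 - 0) / ((1 - 0) ^ 2 / 4) = 2 * lambdaLength a b ^ 2 := by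
    ring
  rw [e] at h3
  refine h3.congr' ?_
  filter_upwards [eventually_gt_atTop 0] with t ht
  have hs : 0 < Real.sinh t := Real.sinh_pos_iff.2 ht
  set d := dist (a.eval t) (b.eval t)
  have e1 : Real.exp ((d - t - t) / 2) ^ 2 = Real.exp d * Real.exp (-(2 * t)) := by
    rw [← Real.exp_nat_mul, ← Real.exp_add]; congr 1; push_cast; ring
  have e2 : Real.exp (-d - 2 * t) = Real.exp (-d) * Real.exp (-(2 * t)) := by
    rw [← Real.exp_add]; congr 1
  have e3 : Real.sinh t ^ 2 * Real.exp (-(2 * t)) = (1 - Real.exp (-(2 * t))) ^ 2 / 4 := by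
    have k1 : Real.exp (-(2 * t)) = Real.exp (-t) ^ 2 := by
      rw [← Real.exp_nat_mul]; congr 1; push_cast; ring
    have k2 : Real.exp t * Real.exp (-t) = 1 := by rw [← Real.exp_add]; simp
    rw [k1, Real.sinh_eq]
    have : ((Real.exp t - Real.exp (-t)) / 2) ^ 2 * Real.exp (-t) ^ 2 =
      ((Real.exp t * Real.exp (-t)) - Real.exp (-t) ^ 2) ^ 2 / 4 := by ring
    rw [this, k2]
  simp only [id, Pi.div_apply]
  rw [e1, e2, ← e3, Real.cosh_eq]
  have := Real.exp_pos (-(2 * t))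
  field_simp

/-- Rays issuing from one point diverge at most as fast as in the hyperbolic plane. -/
lemma IsStewart.cosh_dist_eval_sub_one_le (hX : IsStewart X) {a b : GeodesicRay X}
    (h0 : a.1 0 = b.1 0) {u : ℝ} (hu : 0 ≤ u) :
    Real.cosh (dist (a.eval u) (b.eval u)) - 1 ≤ 2 * lambdaLength a b ^ 2 * Real.sinh u ^ 2 := by
  refine ge_of_tendsto ((tendsto_cosh_dist_div_sinh_sq a b).mul_const (Real.sinh u ^ 2)) ?_
  filter_upwards [eventually_ge_atTop u, eventually_gt_atTop 0] with t ht ht0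
  have hs : 0 < Real.sinh t := Real.sinh_pos_iff.2 ht0
  have da : ∀ {s : ℝ}, 0 ≤ s → dist (a.1 0) (a.eval s) = s := fun {s} hs => by
    rw [← eval_zero, dist_eval a le_rfl hs]; simp [abs_of_nonneg hs]
  have db : ∀ {s : ℝ}, 0 ≤ s → dist (a.1 0) (b.eval s) = s := fun {s} hs => by
    rw [h0, ← eval_zero, dist_eval b le_rfl hs]; simp [abs_of_nonneg hs]
  have := hX.cosh_dist_sub_one_le (x := a.1 0) (y₁ := a.eval t) (y₂ := b.eval t)
    (p₁ := a.eval u) (p₂ := b.eval u) (u := u)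
    (by rw [da hu, da ht0.le, dist_eval a hu ht0.le, abs_sub_comm, abs_of_nonneg]
        · ring
        · linarith)
    (by rw [db hu, db ht0.le, dist_eval b hu ht0.le, abs_sub_comm, abs_of_nonneg]
        · ring
        · linarith) (da hu) (db hu)
  rw [da ht0.le, db ht0.le, sub_self, Real.cosh_zero] at this
  rw [div_mul_eq_mul_div, le_div_iff₀ (by positivity), sq]
  linarith

lemma lambdaLength_eq_zero {a b : GeodesicRay X} (h : a.endpoint = b.endpoint) :
    lambdaLength a b = 0 := by
  obtain ⟨C, hC⟩ := endpoint_eq_iff.1 h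
  refine tendsto_nhds_unique (tendsto_lambdaLength_comp a b tendsto_id tendsto_id) ?_
  refine squeeze_zero (fun _ => (Real.exp_pos _).le) (g := fun t => Real.exp (C / 2) * Real.exp (-t))
    (fun t => ?_) ?_
  · rw [← Real.exp_add, Real.exp_le_exp]
    have : dist (a.eval t) (b.eval t) < C := hC t.toNNReal
    simp only [id]; linarith
  · simpa using Real.tendsto_exp_neg_atTop_nhds_zero.const_mul (Real.exp (C / 2))

lemma IsStewart.eq_of_lambdaLength_eq_zero (hX : IsStewart X) {a b : GeodesicRay X}
    (h0 : a.1 0 = b.1 0) (h : lambdaLength a b = 0) : a = b := by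
  apply Subtype.ext
  funext u
  have := hX.cosh_dist_eval_sub_one_le h0 u.2
  rw [h] at this
  rw [← eval_coe, ← eval_coe]
  refine eq_of_cosh_dist_le_one ?_
  have h2 : Real.cosh (dist (a.eval u) (b.eval u)) - 1 ≤ 2 * 0 ^ 2 * Real.sinh u ^ 2 := this
  simp only [ne_eq, OfNat.ofNat_ne_zero, not_false_eq_true, zero_pow, mul_zero, zero_mul] at h2
  linarith

/-- A ray is determined by its origin and its endpoint. -/
lemma IsStewart.eq_of_endpoint_eq (hX : IsStewart X) {a b : GeodesicRay X}
    (h0 : a.1 0 = b.1 0) (h : a.endpoint = b.endpoint) : a = b :=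
  hX.eq_of_lambdaLength_eq_zero h0 (lambdaLength_eq_zero h)

/-- From every point issues a ray strongly asymptotic to a given ray; it is the limit of the
segments to the points of the given ray. -/
lemma IsStewart.exists_ray_tendsto [CompleteSpace X] (hX : IsStewart X) (c : GeodesicRay X)
    (p : X) : ∃ r : GeodesicRay X, r.1 0 = p ∧
      Tendsto (fun t => dist (c.eval t) (r.eval (t + busemann c p))) atTop (𝓝 0) := by
  choose γ hγ using fun t => hX.exists_geodesic p (c.eval t)
  set d₀ := dist p (c.1 0) with hd₀
  have hL1 : ∀ t, t - d₀ ≤ dist p (c.eval t) := le_dist_eval c p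
  have hlim : ∀ u, ∃ x, 0 ≤ u → Tendsto (fun t => γ t u) atTop (𝓝 x) := fun u => by
    by_cases hu : 0 ≤ u
    swap
    · exact ⟨p, fun h => absurd h hu⟩
    obtain ⟨x, hx⟩ := tendsto_of_cosh_dist_le_exp (f := fun t => γ t u) (t₀ := u + d₀)
      (tendsto_busemann c p) (fun t s ht hts => by
        have h1 := (hγ t).dist_left_right (s := u) ⟨hu, by linarith [hL1 t]⟩
        have h2 := (hγ s).dist_left_right (s := u) ⟨hu, by linarith [hL1 s]⟩
        refine hX.cosh_dist_le_exp (x := p) (y := c.eval s) (by rw [h2.1, h2.2]; ring)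
          (sub_nonneg.2 (antitone_dist_eval_sub c p hts)) ?_ ?_
        · rw [dist_comm, h1.1, h2.1]
          have := antitone_dist_eval_sub c p hts
          simp only at this; linarith
        · have := dist_triangle (γ t u) (c.eval t) (c.eval s)
          rw [h1.2] at this
          have := dist_eval_le c hts
          rw [h2.2]; linarith)
    exact ⟨x, fun _ => hx⟩
  choose r hr using hlim
  have hmem : ∀ u, 0 ≤ u → ∀ᶠ t in atTop, u ∈ Set.Icc 0 (dist p (c.eval t)) := fun u hu => by
    filter_upwards [eventually_ge_atTop (u + d₀)] with t ht
    exact ⟨hu, by linarith [hL1 t]⟩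
  have hiso : ∀ u v, 0 ≤ u → 0 ≤ v → dist (r u) (r v) = |u - v| := fun u v hu hv => by
    refine tendsto_nhds_unique ((hr u hu).dist (hr v hv)) (tendsto_const_nhds.congr' ?_)
    filter_upwards [hmem u hu, hmem v hv] with t h1 h2
    exact ((hγ t).dist_eq u h1 v h2).symm
  refine ⟨⟨fun u => r u, Isometry.of_dist_eq fun u v => ?_⟩, ?_, ?_⟩
  · rw [hiso u v u.2 v.2, NNReal.dist_eq]
  · refine tendsto_nhds_unique (hr 0 le_rfl) ?_
    simp only [(hγ _).source]; exact tendsto_const_nhds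
  · set τ := busemann c p with hτ
    have hτ0 : -d₀ ≤ τ := by
      have := busemann_le_add c (c.1 0) p
      rw [busemann_zero, dist_comm] at this; linarith
    refine tendsto_zero_of_cosh_le (g := fun t => 1 + Real.cosh d₀ * Real.exp (-t)) ?_ ?_
    swap
    · simpa using (Real.tendsto_exp_neg_atTop_nhds_zero.const_mul (Real.cosh d₀)).const_add 1
    filter_upwards [eventually_ge_atTop d₀] with t ht
    have ht0 : 0 ≤ t := dist_nonneg.trans ht
    have hτt : 0 ≤ τ + t := by linarith
    have e : GeodesicRay.eval (⟨fun u => r u, Isometry.of_dist_eq fun u v => by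
        rw [hiso u v u.2 v.2, NNReal.dist_eq]⟩ : GeodesicRay X) (t + τ) = r (τ + t) := by
      simp only [GeodesicRay.eval, add_comm t τ, Real.coe_toNNReal _ hτt]
    rw [e]
    have hb := tendsto_busemann c p
    have hlim : Tendsto (fun T => γ T (dist p (c.eval T) - T + t)) atTop (𝓝 (r (τ + t))) := by
      have h0 : Tendsto (fun T => dist (γ T (τ + t)) (γ T (dist p (c.eval T) - T + t))) atTop
          (𝓝 0) := by
        have h1 : Tendsto (fun T => |τ - (dist p (c.eval T) - T)|) atTop (𝓝 0) := by
          have := (hb.const_sub τ).abs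
          rwa [← hτ, sub_self, abs_zero] at this
        refine h1.congr' ?_
        filter_upwards [hmem _ hτt, eventually_ge_atTop t] with T h1 h2
        rw [(hγ T).dist_eq _ h1 _ ⟨by linarith [hL1 T], by linarith⟩]
        congr 1; ring
      exact tendsto_of_tendsto_of_dist (hr _ hτt) h0
    refine le_of_tendsto ((Real.continuous_cosh.tendsto _).comp
      ((tendsto_const_nhds (x := c.eval t)).dist hlim)) ?_
    filter_upwards [eventually_gt_atTop (t + d₀), eventually_gt_atTop t] with T hT hT'
    set q := γ T (dist p (c.eval T) - T + t) with hq
    have hT0 : 0 < T := by linarith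
    obtain ⟨q1, q2⟩ := (hγ T).dist_left_right (s := dist p (c.eval T) - T + t)
      ⟨by linarith [hL1 T], by linarith⟩
    have hL0 : 0 < dist p (c.eval T) := by linarith [hL1 T]
    have dc : dist (c.eval T) (c.1 0) = T := by
      rw [← eval_zero, dist_eval c hT0.le le_rfl, sub_zero, abs_of_pos hT0]
    have dct : dist (c.eval T) (c.eval t) = T - t := by
      rw [dist_eval c hT0.le ht0, abs_of_pos (by linarith)]
    have key := hX.cosh_dist_sub_one_le (x := c.eval T) (y₁ := c.1 0) (y₂ := p)
      (p₁ := c.eval t) (p₂ := q) (u := T - t)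
      (by rw [dct, dc, ← eval_zero, dist_eval c ht0 le_rfl, sub_zero, abs_of_nonneg ht0]; ring)
      (by rw [dist_comm _ q, q2, dist_comm q, q1, dist_comm _ p]; ring)
      dct (by rw [dist_comm, q2]; ring)
    rw [dc, dist_comm _ p, dist_comm _ p, ← hd₀] at key
    set L := dist p (c.eval T)
    have s1 := sinh_sub_le_exp_mul_sinh (T := T) ht0
    have s2 := sinh_sub_le_exp_mul_sinh (t := L - T + t) (T := L) (by linarith [hL1 T])
    rw [show L - (L - T + t) = T - t by ring] at s2
    have p1 : 0 < Real.sinh T := Real.sinh_pos_iff.2 hT0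
    have p2 : 0 < Real.sinh L := Real.sinh_pos_iff.2 hL0
    have p3 : 0 ≤ Real.sinh (T - t) := Real.sinh_nonneg_iff.2 (by linarith)
    have s3 : Real.exp (-(L - T + t)) ≤ 1 := Real.exp_le_one_iff.2 (by linarith [hL1 T])
    have s4 : Real.sinh (T - t) ^ 2 ≤ Real.exp (-t) * (Real.sinh T * Real.sinh L) := by
      have s5 : Real.sinh (T - t) ≤ Real.sinh L := s2.trans (by nlinarith)
      rw [sq, ← mul_assoc]
      exact mul_le_mul s1 s5 p3 (by positivity)
    have hc1 := Real.one_le_cosh (T - L)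
    have hc2 := Real.cosh_pos d₀
    have s6 : (Real.cosh d₀ - Real.cosh (T - L)) * Real.sinh (T - t) ^ 2 ≤
        Real.cosh d₀ * (Real.exp (-t) * (Real.sinh T * Real.sinh L)) := by
      refine le_trans ?_ (mul_le_mul_of_nonneg_left s4 hc2.le)
      exact mul_le_mul_of_nonneg_right (by linarith) (sq_nonneg _)
    have s7 := key.trans s6
    rw [← mul_assoc (Real.cosh d₀)] at s7
    have := le_of_mul_le_mul_right s7 (by positivity)
    simp only [Function.comp_apply]
    linarith

lemma IsStewart.exists_ray [CompleteSpace X] (hX : IsStewart X) (p : X) (ξ : Boundary X) :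
    ∃ r : GeodesicRay X, r.1 0 = p ∧ r.endpoint = ξ := by
  obtain ⟨c, rfl⟩ := Quotient.exists_rep ξ
  obtain ⟨r, h1, h2⟩ := hX.exists_ray_tendsto c p
  exact ⟨r, h1, (endpoint_eq_of_tendsto h2).symm⟩

/-- Asymptotic rays are strongly asymptotic. -/
lemma IsStewart.exists_tendsto_of_endpoint_eq [CompleteSpace X] (hX : IsStewart X)
    {a b : GeodesicRay X} (h : a.endpoint = b.endpoint) :
    ∃ κ : ℝ, Tendsto (fun t => dist (a.eval t) (b.eval (t + κ))) atTop (𝓝 0) := by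
  obtain ⟨r, h1, h2⟩ := hX.exists_ray_tendsto a (b.1 0)
  obtain rfl := hX.eq_of_endpoint_eq h1 ((endpoint_eq_of_tendsto h2).symm.trans h)
  exact ⟨_, h2⟩

lemma busemann_eq_sub {a b : GeodesicRay X} {κ : ℝ}
    (h : Tendsto (fun t => dist (a.eval t) (b.eval (t + κ))) atTop (𝓝 0)) (p : X) :
    busemann b p = busemann a p - κ := by
  have hκ : Tendsto (fun t : ℝ => t + κ) atTop atTop := tendsto_atTop_add_const_right _ _ tendsto_id
  refine tendsto_nhds_unique ((tendsto_busemann b p).comp hκ) ?_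
  refine tendsto_of_tendsto_of_dist ((tendsto_busemann a p).sub_const κ) ?_
  refine squeeze_zero (fun _ => dist_nonneg) (fun t => ?_) h
  simp only [Function.comp_apply, Real.dist_eq]
  rw [show dist p (a.eval t) - t - κ - (dist p (b.eval (t + κ)) - (t + κ)) =
    dist p (a.eval t) - dist p (b.eval (t + κ)) by ring, dist_comm p, dist_comm p]
  exact abs_dist_sub_le _ _ _

lemma lambdaLength_eq_mul {a b : GeodesicRay X} {κ : ℝ}
    (h : Tendsto (fun t => dist (a.eval t) (b.eval (t + κ))) atTop (𝓝 0)) (c : GeodesicRay X) :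
    lambdaLength b c = lambdaLength a c * Real.exp (-κ / 2) := by
  have hκ : Tendsto (fun t : ℝ => t + κ) atTop atTop := tendsto_atTop_add_const_right _ _ tendsto_id
  refine tendsto_nhds_unique (tendsto_lambdaLength_comp b c hκ tendsto_id) ?_
  have h0 : Tendsto (fun t => dist (b.eval (t + κ)) (c.eval t) - dist (a.eval t) (c.eval t)) atTop
      (𝓝 0) := by
    refine squeeze_zero_norm (fun t => ?_) h
    rw [Real.norm_eq_abs, dist_comm (a.eval t) (b.eval (t + κ))]
    exact abs_dist_sub_le _ _ _
  have h1 := (Real.continuous_exp.tendsto _).comp ((h0.sub_const κ).div_const 2)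
  have h2 := (tendsto_lambdaLength_comp a c tendsto_id tendsto_id).mul h1
  rw [zero_sub] at h2
  refine h2.congr fun t => ?_
  simp only [Function.comp_apply, id]
  rw [← Real.exp_add]
  congr 1; ring

lemma IsStewart.lambdaLength_pos [CompleteSpace X] (hX : IsStewart X) {a b : GeodesicRay X}
    (h : a.endpoint ≠ b.endpoint) : 0 < lambdaLength a b := by
  refine (lambdaLength_nonneg a b).lt_of_ne' fun h0 => h ?_
  obtain ⟨r, h1, h2⟩ := hX.exists_ray_tendsto a (b.1 0)
  have h3 := lambdaLength_eq_mul h2 b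
  rw [h0, zero_mul] at h3
  rw [endpoint_eq_of_tendsto h2, hX.eq_of_lambdaLength_eq_zero h1 h3]

/-! ### Visual metrics and Busemann cocycles on the boundary -/

/-- A ray representing a point at infinity. -/
noncomputable def _root_.Boundary.ray (ξ : Boundary X) : GeodesicRay X :=
  Quotient.out (s := GeodesicRay.asymptotic X) ξ

@[simp] lemma endpoint_ray (ξ : Boundary X) : ξ.ray.endpoint = ξ :=
  Quotient.out_eq (s := GeodesicRay.asymptotic X) ξ

/-- The Busemann cocycle `lim (d(p, c(t)) - d(q, c(t)))`, where `c` is a ray ending at `ξ`. -/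
noncomputable def cocycle (ξ : Boundary X) (p q : X) : ℝ := busemann ξ.ray p - busemann ξ.ray q

/-- Bourdon's visual metric `exp (-(ξ | η)_p)`, where `(ξ | η)_p` is the Gromov product at `p`. In
the hyperbolic plane it is the sine of half the angle at `p` between the rays to `ξ` and `η`. It
equals `1` exactly when `p` lies on the geodesic line joining `ξ` and `η`. -/
noncomputable def visual (p : X) (ξ η : Boundary X) : ℝ :=
  lambdaLength ξ.ray η.ray * Real.exp (-(busemann ξ.ray p + busemann η.ray p) / 2)

lemma IsStewart.cocycle_endpoint [CompleteSpace X] (hX : IsStewart X) (a : GeodesicRay X)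
    (p q : X) : cocycle a.endpoint p q = busemann a p - busemann a q := by
  obtain ⟨κ, h⟩ := hX.exists_tendsto_of_endpoint_eq (endpoint_ray a.endpoint)
  rw [cocycle, busemann_eq_sub h, busemann_eq_sub h]; ring

lemma IsStewart.visual_endpoint [CompleteSpace X] (hX : IsStewart X) (a b : GeodesicRay X)
    (p : X) : visual p a.endpoint b.endpoint =
      lambdaLength a b * Real.exp (-(busemann a p + busemann b p) / 2) := by
  obtain ⟨κ, h⟩ := hX.exists_tendsto_of_endpoint_eq (endpoint_ray a.endpoint)
  obtain ⟨κ', h'⟩ := hX.exists_tendsto_of_endpoint_eq (endpoint_ray b.endpoint)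
  rw [visual, busemann_eq_sub h, busemann_eq_sub h', lambdaLength_eq_mul h,
    lambdaLength_comm _ b, lambdaLength_eq_mul h', lambdaLength_comm b.endpoint.ray, mul_assoc,
    mul_assoc, ← Real.exp_add, ← Real.exp_add]
  congr 2; ring

lemma cocycle_le_dist (ξ : Boundary X) (p q : X) : cocycle ξ p q ≤ dist p q := by
  rw [cocycle]; linarith [busemann_le_add ξ.ray p q]

lemma cocycle_swap (ξ : Boundary X) (p q : X) : cocycle ξ q p = -cocycle ξ p q := by
  rw [cocycle, cocycle]; ring

lemma cocycle_add (ξ : Boundary X) (p q r : X) :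
    cocycle ξ p q + cocycle ξ q r = cocycle ξ p r := by
  rw [cocycle, cocycle, cocycle]; ring

@[simp] lemma cocycle_self (ξ : Boundary X) (p : X) : cocycle ξ p p = 0 := by simp [cocycle]

lemma visual_change (p q : X) (ξ η : Boundary X) :
    visual q ξ η = visual p ξ η * Real.exp ((cocycle ξ p q + cocycle η p q) / 2) := by
  rw [visual, visual, mul_assoc, ← Real.exp_add, cocycle, cocycle]
  congr 2; ring

lemma visual_comm (p : X) (ξ η : Boundary X) : visual p ξ η = visual p η ξ := by
  rw [visual, visual, lambdaLength_comm, add_comm]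

@[simp] lemma visual_self (p : X) (ξ : Boundary X) : visual p ξ ξ = 0 := by
  rw [visual, lambdaLength_self, zero_mul]

lemma visual_nonneg (p : X) (ξ η : Boundary X) : 0 ≤ visual p ξ η :=
  mul_nonneg (lambdaLength_nonneg _ _) (Real.exp_pos _).le

lemma visual_le_one (p : X) (ξ η : Boundary X) : visual p ξ η ≤ 1 := by
  have := mul_le_mul_of_nonneg_right (lambdaLength_le_exp_busemann ξ.ray η.ray p)
    (Real.exp_pos (-(busemann ξ.ray p + busemann η.ray p) / 2)).le
  rwa [← Real.exp_add, neg_div, add_neg_cancel, Real.exp_zero, ← neg_div] at this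

lemma IsStewart.visual_pos [CompleteSpace X] (hX : IsStewart X) (p : X) {ξ η : Boundary X}
    (h : ξ ≠ η) : 0 < visual p ξ η :=
  mul_pos (hX.lambdaLength_pos (by simpa using h)) (Real.exp_pos _)

lemma visual_le_mul_exp_dist (p q : X) (ξ η : Boundary X) :
    visual q ξ η ≤ visual p ξ η * Real.exp (dist p q) := by
  rw [visual_change p q]
  refine mul_le_mul_of_nonneg_left (Real.exp_le_exp.2 ?_) (visual_nonneg _ _ _)
  linarith [cocycle_le_dist ξ p q, cocycle_le_dist η p q]

/-- For rays issuing from `p` the visual metric at `p` is the `λ`-length. -/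
lemma IsStewart.visual_eq_lambdaLength [CompleteSpace X] (hX : IsStewart X) {a b : GeodesicRay X}
    {p : X} (ha : a.1 0 = p) (hb : b.1 0 = p) :
    visual p a.endpoint b.endpoint = lambdaLength a b := by
  have h1 := busemann_zero a
  have h2 := busemann_zero b
  rw [ha] at h1
  rw [hb] at h2
  rw [hX.visual_endpoint, h1, h2]; simp

/-! ### Geodesic lines -/

/-- For each `s` there is a point on the line between the endpoints of `a` and `b` at which the
Busemann function of `a` equals `s`; it satisfies the ideal form of Stewart's inequality. -/
lemma IsStewart.exists_line [CompleteSpace X] (hX : IsStewart X) {a b : GeodesicRay X}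
    (hab : a.endpoint ≠ b.endpoint) (s : ℝ) : ∃ q, busemann a q = s ∧
      busemann b q = 2 * Real.log (lambdaLength a b) - s ∧
      ∀ z, 2 * Real.cosh (dist z q) ≤ Real.exp (busemann a z - s) +
        Real.exp (busemann b z - (2 * Real.log (lambdaLength a b) - s)) := by
  have hpos := hX.lambdaLength_pos hab
  set D := 2 * Real.log (lambdaLength a b) with hD
  set L : ℝ → ℝ := fun t => dist (a.eval t) (b.eval t) with hL
  have hL1 : ∀ t, D + 2 * t ≤ L t := fun t => by
    have := Real.log_le_log hpos (lambdaLength_le a b t t)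
    rw [Real.log_exp] at this
    simp only [hL]; linarith
  have hL2 : Tendsto (fun t => L t - 2 * t) atTop (𝓝 D) := by
    have := ((tendsto_lambdaLength_comp a b tendsto_id tendsto_id).log hpos.ne').const_mul 2
    refine this.congr fun t => ?_
    simp only [id, Real.log_exp, hL]; ring
  have hL3 : Antitone fun t => L t - 2 * t := fun t t' h => by
    have h1 := dist_eval_le a h
    have h2 := dist_eval_le b h
    have := dist_triangle4 (a.eval t') (a.eval t) (b.eval t) (b.eval t')
    rw [dist_comm (a.eval t') (a.eval t)] at this
    simp only [hL]; linarith
  choose γ hγ using fun t => hX.exists_geodesic (a.eval t) (b.eval t)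
  have hγd : ∀ t, max 0 (max (-s) (s - D)) ≤ t →
      dist (a.eval t) (γ t (t + s)) = t + s ∧ dist (γ t (t + s)) (b.eval t) = L t - (t + s) :=
    fun t ht => (hγ t).dist_left_right
      ⟨by linarith [le_max_left (-s) (s - D), le_of_max_le_right ht],
        by have := hL1 t; have := le_max_right (-s) (s - D); have := le_of_max_le_right ht
           simp only [hL] at *; linarith⟩
  obtain ⟨q, hq⟩ := tendsto_of_cosh_dist_le_exp (f := fun t => γ t (t + s))
    (t₀ := max 0 (max (-s) (s - D))) hL2 (fun t t' ht htt' => by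
      obtain ⟨h1, h2⟩ := hγd t ht
      obtain ⟨h3, h4⟩ := hγd t' (ht.trans htt')
      have h5 := hL3 htt'
      simp only at h5
      refine hX.cosh_dist_le_exp (x := a.eval t') (y := b.eval t') (by rw [h3, h4]; simp [hL])
        (sub_nonneg.2 h5) ?_ ?_
      · have := dist_triangle (γ t (t + s)) (a.eval t) (a.eval t')
        rw [dist_comm _ (a.eval t), h1] at this
        have := dist_eval_le a htt'
        rw [h3]; linarith
      · have := dist_triangle (γ t (t + s)) (b.eval t) (b.eval t')
        rw [h2] at this
        have := dist_eval_le b htt'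
        rw [h4]; linarith)
  have hev : ∀ᶠ t : ℝ in atTop, max 0 (max (-s) (s - D)) ≤ t := eventually_ge_atTop _
  have hq0 : Tendsto (fun t => dist q (γ t (t + s))) atTop (𝓝 0) := by
    simpa using (tendsto_const_nhds (x := q)).dist hq
  have hclose : ∀ f : ℝ → X, Tendsto (fun t => dist q (f t) - dist (γ t (t + s)) (f t)) atTop
      (𝓝 0) := fun f =>
    squeeze_zero_norm (fun t => by rw [Real.norm_eq_abs]; exact abs_dist_sub_le _ _ _) hq0
  refine ⟨q, tendsto_nhds_unique (tendsto_busemann a q) ?_,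
    tendsto_nhds_unique (tendsto_busemann b q) ?_, fun z => ?_⟩
  · have := (hclose a.eval).add_const s
    rw [zero_add] at this
    refine this.congr' ?_
    filter_upwards [hev] with t ht
    rw [dist_comm (γ t (t + s)), (hγd t ht).1]; ring
  · have := (hclose b.eval).add (hL2.sub_const s)
    rw [zero_add] at this
    refine this.congr' ?_
    filter_upwards [hev] with t ht
    rw [(hγd t ht).2]; ring
  · have hLt : Tendsto L atTop atTop :=
      tendsto_atTop_mono hL1 (tendsto_atTop_add_const_left _ _ (tendsto_id.const_mul_atTop two_pos))
    have c1 : Tendsto (fun t => 2 * Real.cosh (dist z (γ t (t + s))) * (1 - Real.exp (-L t))) atTop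
        (𝓝 (2 * Real.cosh (dist z q) * (1 - 0))) :=
      (((Real.continuous_cosh.tendsto _).comp ((tendsto_const_nhds (x := z)).dist hq)).const_mul
        2).mul ((Real.tendsto_exp_neg_atTop_nhds_zero.comp hLt).const_sub 1)
    have ca : ∀ c : GeodesicRay X, Tendsto (fun t => Real.exp (dist z (c.eval t) - t) + Real.exp (-t))
        atTop (𝓝 (Real.exp (busemann c z) + 0)) := fun c =>
      ((Real.continuous_exp.tendsto _).comp (tendsto_busemann c z)).add
        Real.tendsto_exp_neg_atTop_nhds_zero
    have c2 := ((ca a).mul_const (Real.exp (-s))).add ((ca b).mul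
      ((Real.continuous_exp.tendsto _).comp (hL2.const_sub s)))
    have c3 := le_of_tendsto_of_tendsto c1 c2 (by
      filter_upwards [hev] with t ht
      obtain ⟨h1, h2⟩ := hγd t ht
      have hS := hX.stewart z (a.eval t) (b.eval t) (γ t (t + s)) (by rw [h1, h2]; simp [hL])
      rw [h1, h2] at hS
      change _ * Real.sinh (L t) ≤ _ at hS
      have hch : ∀ x : ℝ, 0 ≤ x → 2 * Real.cosh x ≤ Real.exp x + 1 := fun x hx => by
        rw [Real.cosh_eq]; linarith [Real.exp_le_one_iff.2 (neg_nonpos.2 hx)]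
      have hsh : ∀ x : ℝ, 2 * Real.sinh x ≤ Real.exp x := fun x => by
        rw [Real.sinh_eq]; linarith [Real.exp_pos (-x)]
      have hL0 : 0 ≤ L t := dist_nonneg
      have k0 : Real.exp (L t) - 1 ≤ 2 * Real.sinh (L t) := by
        rw [Real.sinh_eq]; linarith [Real.exp_le_one_iff.2 (neg_nonpos.2 hL0)]
      have k1 := mul_le_mul_of_nonneg_left k0 (Real.cosh_pos (dist z (γ t (t + s)))).le
      have k2 : (2 * Real.cosh (dist z (a.eval t))) * (2 * Real.sinh (L t - (t + s))) ≤
          (Real.exp (dist z (a.eval t)) + 1) * Real.exp (L t - (t + s)) :=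
        mul_le_mul (hch _ dist_nonneg) (hsh _)
          (mul_nonneg two_pos.le (Real.sinh_nonneg_iff.2 (h2 ▸ dist_nonneg))) (by positivity)
      have k3 : (2 * Real.cosh (dist z (b.eval t))) * (2 * Real.sinh (t + s)) ≤
          (Real.exp (dist z (b.eval t)) + 1) * Real.exp (t + s) :=
        mul_le_mul (hch _ dist_nonneg) (hsh _)
          (mul_nonneg two_pos.le (Real.sinh_nonneg_iff.2 (h1 ▸ dist_nonneg))) (by positivity)
      have k4 : 2 * Real.cosh (dist z (γ t (t + s))) * (Real.exp (L t) - 1) ≤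
          (Real.exp (dist z (a.eval t)) + 1) * Real.exp (L t - (t + s)) +
          (Real.exp (dist z (b.eval t)) + 1) * Real.exp (t + s) := by linarith
      have k5 := mul_le_mul_of_nonneg_right k4 (Real.exp_pos (-L t)).le
      have f0 : Real.exp (L t) * Real.exp (-L t) = 1 := by rw [← Real.exp_add]; simp
      have f1 : Real.exp (L t - (t + s)) * Real.exp (-L t) = Real.exp (-t) * Real.exp (-s) := by
        rw [← Real.exp_add, ← Real.exp_add]; congr 1; ring
      have f2 : Real.exp (t + s) * Real.exp (-L t) =
          Real.exp (-t) * Real.exp (s - (L t - 2 * t)) := by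
        rw [← Real.exp_add, ← Real.exp_add]; congr 1; ring
      have f3 : ∀ x : ℝ, Real.exp (x - t) = Real.exp x * Real.exp (-t) := fun x => by
        rw [← Real.exp_add]; rfl
      simp only [Function.comp_apply]
      rw [f3, f3]
      calc _ = 2 * Real.cosh (dist z (γ t (t + s))) * (Real.exp (L t) - 1) * Real.exp (-L t) := by
            rw [mul_assoc _ (Real.exp (L t) - 1), sub_mul, f0, one_mul]
        _ ≤ _ := k5
        _ = (Real.exp (dist z (a.eval t)) + 1) * (Real.exp (L t - (t + s)) * Real.exp (-L t)) +
          (Real.exp (dist z (b.eval t)) + 1) * (Real.exp (t + s) * Real.exp (-L t)) := by ring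
        _ = _ := by rw [f1, f2]; ring)
    rw [sub_zero, mul_one, add_zero, add_zero, ← Real.exp_add, ← Real.exp_add] at c3
    refine c3.trans_eq ?_
    congr 2; ring

lemma visual_eq_one_iff (p : X) {ξ η : Boundary X} (h : 0 < lambdaLength ξ.ray η.ray) :
    visual p ξ η = 1 ↔
      busemann ξ.ray p + busemann η.ray p = 2 * Real.log (lambdaLength ξ.ray η.ray) := by
  rw [visual, ← Real.exp_log h, ← Real.exp_add, Real.exp_eq_one_iff, Real.exp_log h]
  constructor <;> intro h <;> linarith

/-- The line joining `ξ` and `η` contains points in every position relative to `o`. -/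
lemma IsStewart.exists_visual_eq_one [CompleteSpace X] (hX : IsStewart X) {ξ η : Boundary X}
    (h : ξ ≠ η) (o : X) (s : ℝ) :
    ∃ p, visual p ξ η = 1 ∧ cocycle ξ o p - cocycle η o p = s := by
  have h' : ξ.ray.endpoint ≠ η.ray.endpoint := by simpa using h
  obtain ⟨p, h1, h2, -⟩ := hX.exists_line h' ((busemann ξ.ray o - busemann η.ray o +
    2 * Real.log (lambdaLength ξ.ray η.ray) - s) / 2)
  refine ⟨p, (visual_eq_one_iff p (hX.lambdaLength_pos h')).2 (by rw [h1, h2]; ring), ?_⟩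
  rw [cocycle, cocycle, h1, h2]; ring

/-- The ideal form of Stewart's inequality, for a point `q` on the line joining `ξ` and `η`. -/
lemma IsStewart.two_mul_cosh_le [CompleteSpace X] (hX : IsStewart X) {ξ η : Boundary X}
    (h : ξ ≠ η) {q : X} (hq : visual q ξ η = 1) (z : X) :
    2 * Real.cosh (dist z q) ≤ Real.exp (cocycle ξ z q) + Real.exp (cocycle η z q) := by
  have h' : ξ.ray.endpoint ≠ η.ray.endpoint := by simpa using h
  obtain ⟨p, h1, h2, h3⟩ := hX.exists_line h' (busemann ξ.ray q)
  have hq' := (visual_eq_one_iff q (hX.lambdaLength_pos h')).1 hq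
  have e : 2 * Real.log (lambdaLength ξ.ray η.ray) - busemann ξ.ray q = busemann η.ray q := by
    linarith
  rw [e] at h2 h3
  obtain rfl : q = p := by
    apply eq_of_cosh_dist_le_one
    have := h3 q
    rw [sub_self, sub_self, Real.exp_zero] at this
    linarith
  exact h3 z

/-- Points on a line are at the distance given by the Busemann cocycle. -/
lemma IsStewart.dist_eq_abs_cocycle [CompleteSpace X] (hX : IsStewart X) {ξ η : Boundary X}
    (h : ξ ≠ η) {p q : X} (hp : visual p ξ η = 1) (hq : visual q ξ η = 1) :
    dist p q = |cocycle ξ p q| := by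
  have h' : ξ.ray.endpoint ≠ η.ray.endpoint := by simpa using h
  have h1 := (visual_eq_one_iff p (hX.lambdaLength_pos h')).1 hp
  have h2 := (visual_eq_one_iff q (hX.lambdaLength_pos h')).1 hq
  have e : cocycle η p q = -cocycle ξ p q := by rw [cocycle, cocycle]; linarith
  have := hX.two_mul_cosh_le h hq p
  rw [e] at this
  refine le_antisymm (le_of_cosh_le_cosh dist_nonneg (abs_nonneg _) ?_) ?_
  · rw [Real.cosh_abs, Real.cosh_eq (cocycle ξ p q)]; linarith
  · rw [abs_le']
    refine ⟨cocycle_le_dist _ _ _, ?_⟩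
    rw [← cocycle_swap, dist_comm]; exact cocycle_le_dist _ _ _

lemma busemann_eval (c : GeodesicRay X) {t : ℝ} (ht : 0 ≤ t) : busemann c (c.eval t) = -t := by
  refine tendsto_nhds_unique (tendsto_busemann c _) (tendsto_const_nhds.congr' ?_)
  filter_upwards [eventually_ge_atTop t] with s hs
  rw [dist_eval c ht (ht.trans hs), abs_sub_comm, abs_of_nonneg (by linarith)]; ring

lemma tendsto_exp_busemann (a c : GeodesicRay X) :
    Tendsto (fun t => Real.exp ((busemann a (c.eval t) - t) / 2)) atTop
      (𝓝 (lambdaLength a c)) := by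
  refine tendsto_of_tendsto_of_tendsto_of_le_of_le' tendsto_const_nhds
    (tendsto_lambdaLength_comp a c tendsto_id tendsto_id) ?_ (Eventually.of_forall fun t => ?_)
  · filter_upwards [eventually_ge_atTop 0] with t ht
    have := lambdaLength_le_exp_busemann a c (c.eval t)
    rwa [busemann_eval c ht] at this
  · rw [Real.exp_le_exp]
    have := busemann_le a (c.eval t) t
    simp only [id, dist_comm (a.eval t)]; linarith

/-- Seen from a point of the line joining `ξ` and `η`, the angles between `ω` and the two ends add
up to at least `π`. -/
lemma IsStewart.one_le_visual_sq_add [CompleteSpace X] (hX : IsStewart X) {ξ η : Boundary X}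
    (h : ξ ≠ η) {q : X} (hq : visual q ξ η = 1) (ω : Boundary X) :
    1 ≤ visual q ξ ω ^ 2 + visual q η ω ^ 2 := by
  obtain ⟨a, ha, rfl⟩ := hX.exists_ray q ξ
  obtain ⟨b, hb, rfl⟩ := hX.exists_ray q η
  obtain ⟨c, hc, rfl⟩ := hX.exists_ray q ω
  have a0 := busemann_zero a
  have b0 := busemann_zero b
  rw [ha] at a0
  rw [hb] at b0
  rw [hX.visual_eq_lambdaLength ha hc, hX.visual_eq_lambdaLength hb hc]
  refine ge_of_tendsto (((tendsto_exp_busemann a c).pow 2).add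
    ((tendsto_exp_busemann b c).pow 2)) ?_
  filter_upwards [eventually_ge_atTop 0] with t ht
  have := hX.two_mul_cosh_le h hq (c.eval t)
  have hd : dist (c.eval t) q = t := by
    rw [← hc, ← eval_zero, dist_eval c ht le_rfl]; simp [abs_of_nonneg ht]
  rw [hd, hX.cocycle_endpoint, hX.cocycle_endpoint, a0, b0, sub_zero, sub_zero, Real.cosh_eq]
    at this
  have e : ∀ x : ℝ, Real.exp ((x - t) / 2) ^ 2 = Real.exp x * Real.exp (-t) := fun x => by
    rw [← Real.exp_nat_mul, ← Real.exp_add]; congr 1; push_cast; ring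
  rw [e, e]
  have f : Real.exp t * Real.exp (-t) = 1 := by rw [← Real.exp_add]; simp
  have := Real.exp_pos (-t)
  nlinarith

/-- The Cauchy-Schwarz inequality is an equality for the proportional vectors `(a, b)` and `(y, x)`,
here of length at least `1` and `r`. -/
lemma le_of_proportional {a b x y r : ℝ} (ha : 0 ≤ a) (hb : 0 ≤ b) (hx : 0 ≤ x) (hy : 0 ≤ y)
    (h : a * x = b * y) (h1 : 1 ≤ a ^ 2 + b ^ 2) (hr : r ^ 2 ≤ x ^ 2 + y ^ 2) :
    r ≤ a * y + b * x := by
  refine le_of_sq_le_sq ?_ (by positivity)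
  have e : (a * y + b * x) ^ 2 = (a ^ 2 + b ^ 2) * (x ^ 2 + y ^ 2) := by
    have : (a ^ 2 + b ^ 2) * (x ^ 2 + y ^ 2) = (a * y + b * x) ^ 2 + (a * x - b * y) ^ 2 := by ring
    rw [this, h]; ring
  rw [e]
  nlinarith [sq_nonneg x, sq_nonneg y]

/-- The triangle inequality for the visual metric: Ptolemy's inequality for `ξ`, `η`, `ω` and
`o`, obtained at the right point of the line joining `ξ` and `η`. -/
lemma IsStewart.visual_triangle [CompleteSpace X] (hX : IsStewart X) (o : X)
    (ξ ω η : Boundary X) : visual o ξ η ≤ visual o ξ ω + visual o ω η := by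
  rcases eq_or_ne ξ η with rfl | hξη
  · rw [visual_self]; exact add_nonneg (visual_nonneg _ _ _) (visual_nonneg _ _ _)
  rcases eq_or_ne ξ ω with rfl | hξω
  · simp
  rcases eq_or_ne ω η with rfl | hωη
  · simp
  have v1 := hX.visual_pos o hξω
  have v2 := hX.visual_pos o hωη
  obtain ⟨p, hp, hs⟩ := hX.exists_visual_eq_one hξη o
    (Real.log (visual o ω η / visual o ξ ω))
  have k1 := hX.two_mul_cosh_le hξη hp o
  have k2 := hX.one_le_visual_sq_add hξη hp ω
  have hx : ∀ ζ : Boundary X, Real.exp (cocycle ζ o p) = Real.exp (cocycle ζ o p / 2) ^ 2 :=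
    fun ζ => by rw [← Real.exp_nat_mul]; congr 1; push_cast; ring
  have hv : ∀ ζ ζ' : Boundary X, visual p ζ ζ' =
      visual o ζ ζ' * (Real.exp (cocycle ζ o p / 2) * Real.exp (cocycle ζ' o p / 2)) :=
    fun ζ ζ' => by rw [visual_change o p, ← Real.exp_add, add_div]
  have k3 : Real.exp (cocycle ω o p) ≤ 2 * Real.cosh (dist o p) := by
    rw [Real.cosh_eq]
    have := Real.exp_le_exp.2 (cocycle_le_dist ω o p)
    linarith [Real.exp_pos (-dist o p)]
  have k4 : visual o ξ ω * Real.exp (cocycle ξ o p) = visual o ω η * Real.exp (cocycle η o p) := by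
    have : Real.exp (cocycle ξ o p) = visual o ω η / visual o ξ ω * Real.exp (cocycle η o p) := by
      rw [← Real.exp_log (div_pos v2 v1), ← Real.exp_add, ← hs]; congr 1; ring
    rw [this]; field_simp
  rw [hx, hx] at k1 k4
  rw [hx] at k3
  rw [hv] at hp
  rw [hv ξ ω, hv η ω, visual_comm o η] at k2
  have x1 := Real.exp_pos (cocycle ξ o p / 2)
  have x2 := Real.exp_pos (cocycle η o p / 2)
  have x3 := Real.exp_pos (cocycle ω o p / 2)
  set x := Real.exp (cocycle ξ o p / 2)
  set y := Real.exp (cocycle η o p / 2)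
  set w := Real.exp (cocycle ω o p / 2)
  have key := le_of_proportional (r := w) (by positivity) (by positivity) x1.le x2.le
    (by linear_combination w * k4) k2 (k3.trans k1)
  refine le_of_mul_le_mul_right (a := x * y * w) ?_ (by positivity)
  calc visual o ξ η * (x * y * w) = visual o ξ η * (x * y) * w := by ring
    _ = w := by rw [hp, one_mul]
    _ ≤ _ := key
    _ = _ := by ring

/-! ### Isometries and cross ratios -/

section Isometry

variable {Y : Type*} [MetricSpace Y]

lemma eval_map {F : X → Y} (hF : Isometry F) (a : GeodesicRay X) (t : ℝ) :
    (a.map F hF).eval t = F (a.eval t) := rfl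

lemma map_endpoint {F : X → Y} (hF : Isometry F) (a : GeodesicRay X) :
    Boundary.map F hF a.endpoint = (a.map F hF).endpoint := rfl

lemma visual_map [CompleteSpace X] [CompleteSpace Y] (hX : IsStewart X) (hY : IsStewart Y)
    {F : X → Y} (hF : Isometry F) (p : X) (ξ η : Boundary X) :
    visual (F p) (Boundary.map F hF ξ) (Boundary.map F hF η) = visual p ξ η := by
  obtain ⟨a, ha, rfl⟩ := hX.exists_ray p ξ
  obtain ⟨b, hb, rfl⟩ := hX.exists_ray p η
  rw [map_endpoint, map_endpoint, hX.visual_eq_lambdaLength ha hb,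
    hY.visual_eq_lambdaLength (p := F p) (by rw [← ha]; rfl) (by rw [← hb]; rfl)]
  simp only [lambdaLength, eval_map, hF.dist_eq]

end Isometry

lemma IsStewart.hasCrossRatio [CompleteSpace X] (hX : IsStewart X) (p : X)
    {ξ₀ η₀ ξ₁ η₁ : Boundary X} (h : ξ₀ ≠ η₁) (h' : ξ₁ ≠ η₀) :
    HasCrossRatio ξ₀ η₀ ξ₁ η₁
      (visual p ξ₀ ξ₁ * visual p η₀ η₁ / (visual p ξ₀ η₁ * visual p ξ₁ η₀)) := by
  rintro a₀ b₀ a₁ b₁ rfl rfl rfl rfl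
  have e : visual p a₀.endpoint a₁.endpoint * visual p b₀.endpoint b₁.endpoint /
      (visual p a₀.endpoint b₁.endpoint * visual p a₁.endpoint b₀.endpoint) =
      lambdaLength a₀ a₁ * lambdaLength b₀ b₁ / (lambdaLength a₀ b₁ * lambdaLength a₁ b₀) := by
    have l1 := hX.lambdaLength_pos h
    have l2 := hX.lambdaLength_pos h'
    simp only [hX.visual_endpoint, neg_add, add_div, Real.exp_add]
    field_simp
  rw [e]
  have key : ∀ (a b : GeodesicRay X) {f g : ℝ≥0 × ℝ≥0 × ℝ≥0 × ℝ≥0 → ℝ≥0},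
      Tendsto f atTop atTop → Tendsto g atTop atTop →
      Tendsto (fun t => Real.exp ((dist (a.1 (f t)) (b.1 (g t)) - f t - g t) / 2)) atTop
        (𝓝 (lambdaLength a b)) := fun a b f g hf hg => by
    have hfg : Tendsto (fun t => ((f t : ℝ), (g t : ℝ))) atTop atTop := by
      rw [← prod_atTop_atTop_eq (α := ℝ)]
      exact (NNReal.tendsto_coe_atTop.2 hf).prodMk (NNReal.tendsto_coe_atTop.2 hg)
    refine ((tendsto_lambdaLength a b).comp hfg).congr fun t => ?_
    simp
  have p1 : Tendsto (fun t : ℝ≥0 × ℝ≥0 × ℝ≥0 × ℝ≥0 => t.1) atTop atTop := by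
    simp only [← prod_atTop_atTop_eq]; exact tendsto_fst
  have p2 : Tendsto (fun t : ℝ≥0 × ℝ≥0 × ℝ≥0 × ℝ≥0 => t.2.1) atTop atTop := by
    simp only [← prod_atTop_atTop_eq]; exact tendsto_fst.comp tendsto_snd
  have p3 : Tendsto (fun t : ℝ≥0 × ℝ≥0 × ℝ≥0 × ℝ≥0 => t.2.2.1) atTop atTop := by
    simp only [← prod_atTop_atTop_eq]; exact tendsto_fst.comp (tendsto_snd.comp tendsto_snd)
  have p4 : Tendsto (fun t : ℝ≥0 × ℝ≥0 × ℝ≥0 × ℝ≥0 => t.2.2.2) atTop atTop := by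
    simp only [← prod_atTop_atTop_eq]; exact tendsto_snd.comp (tendsto_snd.comp tendsto_snd)
  refine (((key a₀ a₁ p1 p3).mul (key b₀ b₁ p2 p4)).div
    ((key a₀ b₁ p1 p4).mul (key a₁ b₀ p3 p2))
    (mul_pos (hX.lambdaLength_pos h) (hX.lambdaLength_pos h')).ne').congr fun t => ?_
  simp only [Pi.div_apply]
  rw [← Real.exp_add, ← Real.exp_add, ← Real.exp_sub]
  congr 1; ring

/-- The cross ratio in terms of a visual metric. -/
lemma IsStewart.crossRatio_eq [CompleteSpace X] (hX : IsStewart X) (p : X)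
    {ξ₀ η₀ ξ₁ η₁ : Boundary X} (h : ξ₀ ≠ η₁) (h' : ξ₁ ≠ η₀) :
    crossRatio ξ₀ η₀ ξ₁ η₁ =
      visual p ξ₀ ξ₁ * visual p η₀ η₁ / (visual p ξ₀ η₁ * visual p ξ₁ η₀) := by
  have hex : ∃ r, HasCrossRatio ξ₀ η₀ ξ₁ η₁ r := ⟨_, hX.hasCrossRatio p h h'⟩
  rw [crossRatio, dif_pos hex]
  exact tendsto_nhds_unique
    (hex.choose_spec ξ₀.ray η₀.ray ξ₁.ray η₁.ray (by simp) (by simp) (by simp) (by simp))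
    (hX.hasCrossRatio p h h' ξ₀.ray η₀.ray ξ₁.ray η₁.ray (by simp) (by simp) (by simp) (by simp))

/-! ### Convergence in the boundary -/

/-- The boundary is complete with respect to a visual metric. -/
lemma IsStewart.exists_tendsto_visual [CompleteSpace X] (hX : IsStewart X) (o : X)
    {x : ℕ → Boundary X}
    (h : Tendsto (fun n : ℕ × ℕ => visual o (x n.1) (x n.2)) atTop (𝓝 0)) :
    ∃ y, Tendsto (fun k => visual o (x k) y) atTop (𝓝 0) := by
  choose c hc hcx using fun k => hX.exists_ray o (x k)
  have hv : ∀ m n, visual o (x m) (x n) = lambdaLength (c m) (c n) := fun m n => by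
    rw [← hcx m, ← hcx n, hX.visual_eq_lambdaLength (hc m) (hc n)]
  have hd : ∀ m n u, 0 ≤ u → Real.cosh (dist ((c m).eval u) ((c n).eval u)) ≤
      1 + 2 * visual o (x m) (x n) ^ 2 * Real.sinh u ^ 2 := fun m n u hu => by
    rw [hv]
    linarith [hX.cosh_dist_eval_sub_one_le ((hc m).trans (hc n).symm) hu]
  have hlim : ∀ u : ℝ≥0, ∃ y, Tendsto (fun n => (c n).eval u) atTop (𝓝 y) := fun u => by
    apply cauchySeq_tendsto_of_complete
    rw [cauchySeq_iff_tendsto_dist_atTop_0]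
    refine tendsto_zero_of_cosh_le (Eventually.of_forall fun n => hd n.1 n.2 u u.2) ?_
    have := (((h.pow 2).const_mul 2).mul_const (Real.sinh u ^ 2)).const_add 1
    simpa using this
  choose r hr using hlim
  have hiso : Isometry r := Isometry.of_dist_eq fun u v => by
    refine tendsto_nhds_unique ((hr u).dist (hr v)) (tendsto_const_nhds.congr fun n => ?_)
    rw [eval_coe, eval_coe, (c n).2.dist_eq]
  let a : GeodesicRay X := ⟨r, hiso⟩
  have ha : a.1 0 = o := by
    refine tendsto_nhds_unique (hr 0) (tendsto_const_nhds.congr fun n => ?_)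
    rw [NNReal.coe_zero, eval_zero, hc]
  refine ⟨a.endpoint, ?_⟩
  rw [Metric.tendsto_atTop]
  intro ε hε
  obtain ⟨N, hN⟩ := eventually_atTop.1 (h.eventually_lt_const (half_pos hε))
  refine ⟨max N.1 N.2, fun k hk => ?_⟩
  rw [Real.dist_eq, sub_zero, abs_of_nonneg (visual_nonneg _ _ _), ← hcx k,
    hX.visual_eq_lambdaLength (hc k) ha]
  suffices 2 * lambdaLength (c k) a ^ 2 ≤ 2 * (ε / 2) ^ 2 by
    have : lambdaLength (c k) a ≤ ε / 2 := le_of_sq_le_sq (by linarith) (by positivity)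
    linarith
  refine le_of_tendsto (tendsto_cosh_dist_div_sinh_sq (c k) a) ?_
  filter_upwards [eventually_gt_atTop 0] with u hu
  have hs : 0 < Real.sinh u := Real.sinh_pos_iff.2 hu
  rw [div_le_iff₀ (by positivity)]
  have hu' : a.eval u = r ⟨u, hu.le⟩ := by
    rw [GeodesicRay.eval, Real.toNNReal_of_nonneg hu.le]; rfl
  have ht : Tendsto (fun n => Real.cosh (dist ((c k).eval u) ((c n).eval u)) - 1) atTop
      (𝓝 (Real.cosh (dist ((c k).eval u) (a.eval u)) - 1)) := by
    rw [hu']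
    exact ((Real.continuous_cosh.tendsto _).comp
      ((tendsto_const_nhds (x := (c k).eval u)).dist (hr ⟨u, hu.le⟩))).sub_const 1
  refine le_of_tendsto ht ?_
  filter_upwards [eventually_ge_atTop (max N.1 N.2)] with n hn
  have h1 := hd k n u hu.le
  have h2 : visual o (x k) (x n) < ε / 2 :=
    hN (k, n) ⟨le_of_max_le_left hk, le_of_max_le_right hn⟩
  have h3 : visual o (x k) (x n) ^ 2 ≤ (ε / 2) ^ 2 :=
    pow_le_pow_left₀ (visual_nonneg _ _ _) h2.le 2
  have h4 := mul_le_mul_of_nonneg_right h3 (sq_nonneg (Real.sinh u))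
  linarith

/-- Convergence in a visual metric implies convergence in the cone topology. -/
lemma IsStewart.tendsto_cone [CompleteSpace X] (hX : IsStewart X) (o : X) {x : ℕ → Boundary X}
    {y : Boundary X} (h : Tendsto (fun k => visual o (x k) y) atTop (𝓝 0)) :
    Tendsto x atTop (@nhds (Boundary X) (coneTopology o) y) := by
  choose c hc hcx using fun k => hX.exists_ray o (x k)
  obtain ⟨a, ha, rfl⟩ := hX.exists_ray o y
  let _ := rayTopology o
  let _ := coneTopology o
  have hcont : Continuous (fun c : {c : GeodesicRay X // c.1 0 = o} => c.1.endpoint) :=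
    continuous_coinduced_rng
  suffices hlim : Tendsto (fun k => (⟨c k, hc k⟩ : {c : GeodesicRay X // c.1 0 = o})) atTop
      (𝓝 ⟨a, ha⟩) by
    exact ((hcont.tendsto _).comp hlim).congr hcx
  have hind : IsInducing (fun c : {c : GeodesicRay X // c.1 0 = o} =>
      (⟨c.1.1, c.1.2.continuous⟩ : C(ℝ≥0, X))) := ⟨rfl⟩
  rw [hind.tendsto_nhds_iff, ContinuousMap.tendsto_iff_forall_isCompact_tendstoUniformlyOn]
  intro K hK
  obtain ⟨U, hU⟩ := hK.bddAbove
  rw [Metric.tendstoUniformlyOn_iff]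
  intro ε hε
  have hg : Tendsto (fun k => 1 + 2 * visual o (x k) a.endpoint ^ 2 * Real.sinh U ^ 2) atTop
      (𝓝 1) := by
    have := (((h.pow 2).const_mul 2).mul_const (Real.sinh U ^ 2)).const_add 1
    simpa using this
  filter_upwards [hg.eventually_lt_const (Real.one_lt_cosh.2 hε.ne')] with k hk u hu
  have h1 := hX.cosh_dist_eval_sub_one_le ((hc k).trans ha.symm) u.2
  rw [← hX.visual_eq_lambdaLength (hc k) ha, hcx k] at h1
  have h2 : Real.sinh u ^ 2 ≤ Real.sinh U ^ 2 :=
    pow_le_pow_left₀ (Real.sinh_nonneg_iff.2 u.2) (Real.sinh_le_sinh.2 (hU hu)) 2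
  have h3 := mul_le_mul_of_nonneg_left h2
    (show 0 ≤ 2 * visual o (x k) a.endpoint ^ 2 by positivity)
  change Real.cosh (dist ((c k).eval (u : ℝ)) (a.eval (u : ℝ))) - 1 ≤
    2 * visual o (x k) a.endpoint ^ 2 * Real.sinh (u : ℝ) ^ 2 at h1
  rw [eval_coe, eval_coe] at h1
  change dist (a.1 u) ((c k).1 u) < ε
  rw [dist_comm, ← abs_of_nonneg (dist_nonneg (x := (c k).1 u)), ← abs_of_pos hε]
  exact Real.cosh_lt_cosh.1 (by linarith)

/-- Visual metrics are continuous with respect to themselves. -/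
lemma IsStewart.tendsto_visual [CompleteSpace X] (hX : IsStewart X) (o : X)
    {x y : ℕ → Boundary X} {a b : Boundary X}
    (hx : Tendsto (fun k => visual o (x k) a) atTop (𝓝 0))
    (hy : Tendsto (fun k => visual o (y k) b) atTop (𝓝 0)) :
    Tendsto (fun k => visual o (x k) (y k)) atTop (𝓝 (visual o a b)) := by
  rw [tendsto_iff_dist_tendsto_zero]
  refine squeeze_zero (fun _ => dist_nonneg) (fun k => ?_) (by simpa using hx.add hy)
  rw [Real.dist_eq, abs_le]
  have h1 := hX.visual_triangle o (x k) a (y k)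
  have h2 := hX.visual_triangle o a b (y k)
  have h3 := hX.visual_triangle o a (x k) b
  have h4 := hX.visual_triangle o (x k) (y k) b
  rw [visual_comm o a (x k)] at h3
  rw [visual_comm o b (y k)] at h2
  constructor <;> linarith

/-- A ray along which the Busemann function of `ζ` decreases at unit speed ends at `ζ`. -/
lemma IsStewart.endpoint_eq_of_cocycle [CompleteSpace X] (hX : IsStewart X) {c : GeodesicRay X}
    {ζ : Boundary X} (h : ∀ t, 0 ≤ t → cocycle ζ (c.eval t) (c.1 0) = -t) : c.endpoint = ζ := by
  obtain ⟨r, hr, rfl⟩ := hX.exists_ray (c.1 0) ζ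
  have h0 : lambdaLength r c = 0 := by
    refine tendsto_nhds_unique (tendsto_exp_busemann r c) ?_
    refine Real.tendsto_exp_neg_atTop_nhds_zero.congr' ?_
    filter_upwards [eventually_ge_atTop 0] with t ht
    have := h t ht
    rw [hX.cocycle_endpoint, ← hr, busemann_zero, sub_zero] at this
    rw [this]; congr 1; ring
  rw [hX.eq_of_lambdaLength_eq_zero hr h0]

/-! ### Separation of the sides of ideal triangles -/

lemma continuous_busemann (c : GeodesicRay X) : Continuous (busemann c) :=
  (LipschitzWith.of_le_add fun p q => busemann_le_add c p q).continuous

lemma continuous_visual (ξ η : Boundary X) : Continuous fun p => visual p ξ η := by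
  unfold visual
  have := continuous_busemann ξ.ray
  have := continuous_busemann η.ray
  fun_prop

/-- If the sides of the ideal triangle `u`, `v`, `w` issuing from `u` do not meet, they come close
to each other only far away from the side opposite to `u`. -/
lemma IsStewart.exists_visual_lt [CompleteSpace X] (hX : IsStewart X) {u v w : Boundary X}
    (huv : u ≠ v) (huw : u ≠ w) (hvw : v ≠ w)
    (hsep : ∀ q, visual q u v = 1 → visual q u w ≠ 1) {δ : ℝ} (hδ : 0 < δ) :
    ∃ ε > 0, ∀ q, 1 - ε < visual q u v → 1 - ε < visual q u w → visual q v w < δ := by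
  by_contra! hcon
  choose q hq1 hq2 hq3 using fun n : ℕ => hcon (1 / ((n : ℝ) + 1)) (by positivity)
  have hone : Tendsto (fun n : ℕ => 1 - 1 / ((n : ℝ) + 1)) atTop (𝓝 1) := by
    simpa using (tendsto_one_div_add_atTop_nhds_zero_nat (𝕜 := ℝ)).const_sub 1
  have l1 : Tendsto (fun n => visual (q n) u v) atTop (𝓝 1) :=
    tendsto_of_tendsto_of_tendsto_of_le_of_le hone tendsto_const_nhds (fun n => (hq1 n).le)
      fun n => visual_le_one _ _ _
  have l2 : Tendsto (fun n => visual (q n) u w) atTop (𝓝 1) :=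
    tendsto_of_tendsto_of_tendsto_of_le_of_le hone tendsto_const_nhds (fun n => (hq2 n).le)
      fun n => visual_le_one _ _ _
  obtain ⟨l, hl, φ, hφ, l3⟩ := (isCompact_Icc (a := δ) (b := 1)).tendsto_subseq
    (x := fun n => visual (q n) v w) fun n => ⟨hq3 n, visual_le_one _ _ _⟩
  have hl0 : 0 < l := hδ.trans_le hl.1
  set o := q 0
  -- The three Gromov products determine the Busemann function of `u`.
  have hexp : ∀ p, Real.exp (cocycle u o p) = visual p u v * visual p u w / visual p v w *
      (visual o v w / (visual o u v * visual o u w)) := fun p => by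
    have := hX.visual_pos o huv
    have := hX.visual_pos o huw
    have := hX.visual_pos o hvw
    rw [visual_change o p u v, visual_change o p u w, visual_change o p v w]
    field_simp
    rw [← Real.exp_add, ← Real.exp_add]
    congr 1; ring
  have l4 : Tendsto (fun n => cocycle u o (q (φ n))) atTop
      (𝓝 (Real.log (1 * 1 / l * (visual o v w / (visual o u v * visual o u w))))) := by
    have h1 := ((((l1.comp hφ.tendsto_atTop).mul (l2.comp hφ.tendsto_atTop)).div l3
      hl0.ne').mul_const (visual o v w / (visual o u v * visual o u w))).log (by
        have := hX.visual_pos o huv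
        have := hX.visual_pos o huw
        have := hX.visual_pos o hvw
        positivity)
    refine h1.congr fun n => ?_
    have := hexp (q (φ n))
    rw [← Real.log_exp (cocycle u o (q (φ n))), this]
    rfl
  -- Points on the line from `u` to `v` in the same position as the points `q n`.
  choose p hp1 hp2 using fun n => hX.exists_visual_eq_one huv (q (φ n)) 0
  have l5 : Tendsto (fun n => dist (q (φ n)) (p n)) atTop (𝓝 0) := by
    refine tendsto_zero_of_cosh_le (g := fun n => (visual (q (φ n)) u v)⁻¹)
      (Eventually.of_forall fun n => ?_) ?_
    · have h1 := hX.two_mul_cosh_le huv (hp1 n) (q (φ n))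
      have h2 := hp1 n
      rw [visual_change (q (φ n)), ← sub_eq_zero.1 (hp2 n), ← two_mul,
        mul_div_cancel_left₀ _ two_ne_zero] at h2
      rw [← sub_eq_zero.1 (hp2 n)] at h1
      rw [eq_inv_of_mul_eq_one_right h2] at h1
      linarith
    · have := (l1.comp hφ.tendsto_atTop).inv₀ one_ne_zero
      rwa [inv_one] at this
  have l6 : CauchySeq fun n => cocycle u o (p n) := by
    have h1 : Tendsto (fun n => cocycle u (q (φ n)) (p n)) atTop (𝓝 0) := by
      refine squeeze_zero_norm (fun n => ?_) l5
      rw [Real.norm_eq_abs, abs_le', ← cocycle_swap]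
      exact ⟨cocycle_le_dist _ _ _, (cocycle_le_dist _ _ _).trans_eq (dist_comm _ _)⟩
    exact ((l4.add h1).congr fun n => cocycle_add u o _ _).cauchySeq
  have l7 : CauchySeq p := by
    rw [Metric.cauchySeq_iff] at l6 ⊢
    intro ε hε
    obtain ⟨N, hN⟩ := l6 ε hε
    refine ⟨N, fun m hm n hn => ?_⟩
    have := hN m hm n hn
    rw [hX.dist_eq_abs_cocycle huv (hp1 m) (hp1 n)]
    rw [Real.dist_eq, abs_sub_comm] at this
    convert this using 2
    rw [← cocycle_add u (p m) o (p n), cocycle_swap u o (p m)]; ring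
  obtain ⟨z, hz⟩ := cauchySeq_tendsto_of_complete l7
  have hz' : Tendsto (fun n => q (φ n)) atTop (𝓝 z) :=
    tendsto_of_tendsto_of_dist hz (l5.congr fun n => dist_comm _ _)
  have e1 := tendsto_nhds_unique (((continuous_visual u v).tendsto z).comp hz')
    (l1.comp hφ.tendsto_atTop)
  have e2 := tendsto_nhds_unique (((continuous_visual u w).tendsto z).comp hz')
    (l2.comp hφ.tendsto_atTop)
  exact hsep z e1 e2

end Stewart

/-! ### The boundary of the hyperbolic plane -/

/-- The null vector of the Lorentzian form with spinor `v`. -/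
def nullVec (v : ℝ × ℝ) : ℝ × ℝ × ℝ := (v.1 ^ 2, v.1 * v.2, v.2 ^ 2)

/-- The symplectic form on spinors. -/
def wedge (v w : ℝ × ℝ) : ℝ := v.1 * w.2 - v.2 * w.1

lemma lor_nullVec (v w : ℝ × ℝ) : lor (nullVec v) (nullVec w) = wedge v w ^ 2 / 2 := by
  simp only [lor, nullVec, wedge]; ring

lemma abs_wedge_congr {v v' : ℝ × ℝ} (h : nullVec v = nullVec v') (w : ℝ × ℝ) :
    |wedge v w| = |wedge v' w| := by
  have h1 := lor_nullVec v w
  rw [h, lor_nullVec] at h1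
  exact (sq_eq_sq_iff_abs_eq_abs _ _).1 (by linarith)

lemma abs_wedge_comm (v w : ℝ × ℝ) : |wedge v w| = |wedge w v| := by
  rw [← abs_neg]; congr 1; simp only [wedge]; ring

lemma exp_neg_sq_add (t : ℝ) :
    Real.exp (-t) * Real.exp (-t) + 2 * (Real.exp (-t) * Real.sinh t) = 1 := by
  have : Real.exp t * Real.exp (-t) = 1 := by rw [← Real.exp_add]; simp
  rw [Real.sinh_eq]; linear_combination this

/-- The geodesic line through `z` ending at the null vector with spinor `v`. -/
lemma exists_isometry_vec_eq {z : ℍ} {v : ℝ × ℝ} (h : lor (vec z) (nullVec v) = 1) :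
    ∃ γ : ℝ → ℍ, Isometry γ ∧
      ∀ t, vec (γ t) = Real.exp (-t) • vec z + Real.sinh t • nullVec v := by
  have key : ∀ t, ∃ p : ℍ, vec p = Real.exp (-t) • vec z + Real.sinh t • nullVec v := fun t => by
    apply exists_vec_eq
    · simp only [lor_add_left, lor_add_right, lor_smul_left, lor_smul_right, lor_vec_self, h,
        lor_comm (nullVec v) (vec z), lor_nullVec, wedge]
      linear_combination exp_neg_sq_add t
    · have hA := vec_fst_pos z
      have hdet := lor_vec_self z
      generalize vec z = u at *
      obtain ⟨A, B, C⟩ := u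
      obtain ⟨a, b⟩ := v
      simp only [lor, nullVec] at h hA hdet
      simp only [nullVec, Prod.fst_add, Prod.smul_fst, smul_eq_mul]
      have e : 2 * A = (A * b - B * a) ^ 2 + a ^ 2 := by
        linear_combination (-2 * A) * h + a ^ 2 * hdet
      have e2 : Real.exp (-t) * A + Real.sinh t * a ^ 2 =
          Real.exp (-t) * ((A * b - B * a) ^ 2 / 2) + Real.exp t * (a ^ 2 / 2) := by
        rw [Real.sinh_eq]; linear_combination (Real.exp (-t) / 2) * e
      rw [e2]
      rcases (sq_nonneg (A * b - B * a)).eq_or_lt with h0 | h0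
      · have : 0 < a ^ 2 := by linarith
        positivity
      · positivity
  choose γ hγ using key
  refine ⟨γ, Isometry.of_dist_eq fun s t => ?_, hγ⟩
  have : Real.cosh (dist (γ s) (γ t)) = Real.cosh (s - t) := by
    rw [← lor_vec, hγ, hγ]
    simp only [lor_add_left, lor_add_right, lor_smul_left, lor_smul_right, lor_vec_self, h,
      lor_comm (nullVec v) (vec z), lor_nullVec, wedge]
    have h1 : Real.exp s * Real.exp (-s) = 1 := by rw [← Real.exp_add]; simp
    have h2 : Real.exp t * Real.exp (-t) = 1 := by rw [← Real.exp_add]; simp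
    have h3 : Real.exp (s - t) = Real.exp s * Real.exp (-t) := by rw [← Real.exp_add]; rfl
    have h4 : Real.exp (-(s - t)) = Real.exp (-s) * Real.exp t := by
      rw [← Real.exp_add]; congr 1; ring
    rw [Real.cosh_eq, h3, h4, Real.sinh_eq, Real.sinh_eq]
    ring
  rw [← Real.cosh_abs (s - t)] at this
  rw [Real.dist_eq]
  exact le_antisymm (le_of_cosh_le_cosh dist_nonneg (abs_nonneg _) this.le)
    (le_of_cosh_le_cosh (abs_nonneg _) dist_nonneg this.ge)

/-- The spinor of the endpoint of the ray from `z` through `z'`. -/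
lemma exists_spinor {z z' : ℍ} (h : z ≠ z') : ∃ v, lor (vec z) (nullVec v) = 1 ∧
    vec z' = Real.exp (-dist z z') • vec z + Real.sinh (dist z z') • nullVec v := by
  have hS : 0 < Real.sinh (dist z z') := Real.sinh_pos_iff.2 (dist_pos.2 h)
  set L := dist z z' with hL
  set n : ℝ × ℝ × ℝ := (1 / Real.sinh L) • (vec z' + (-Real.exp (-L)) • vec z) with hn
  have hce : Real.cosh L = Real.exp (-L) + Real.sinh L := by
    linarith [Real.cosh_sub_sinh L]
  have hzn : lor (vec z) n = 1 := by
    simp only [hn, lor_add_right, lor_smul_right, lor_vec_self, lor_vec]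
    rw [← hL, hce]; field_simp; ring
  have hnn : lor n n = 0 := by
    simp only [hn, lor_add_right, lor_smul_right, lor_add_left, lor_smul_left, lor_vec_self,
      lor_vec, dist_comm z' z]
    rw [← hL, hce]
    have := exp_neg_sq_add L
    field_simp
    linear_combination -this
  have hv : vec z' = Real.exp (-L) • vec z + Real.sinh L • n := by
    rw [hn, smul_smul, mul_one_div_cancel hS.ne', one_smul, neg_smul]; abel
  have hA := vec_fst_pos z
  have hdet := lor_vec_self z
  suffices ∃ v, nullVec v = n by
    obtain ⟨v, h⟩ := this
    exact ⟨v, by rw [h]; exact hzn, by rw [h]; exact hv⟩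
  clear hv hn
  generalize vec z = u at *
  clear_value n
  obtain ⟨A, B, C⟩ := u
  obtain ⟨N₁, N₂, N₃⟩ := n
  simp only [lor] at hzn hnn hdet hA
  have h1 : 0 ≤ N₁ := by
    have : A * (2 * N₁) = (A * N₂ - B * N₁) ^ 2 + N₁ ^ 2 := by
      linear_combination (-2 * A * N₁) * hzn + A ^ 2 * hnn + N₁ ^ 2 * hdet
    have h0 : 0 ≤ A * (2 * N₁) := by rw [this]; positivity
    have := nonneg_of_mul_nonneg_right h0 hA
    linarith
  rcases h1.eq_or_lt with h0 | h0
  · subst h0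
    have hN2 : N₂ = 0 := by
      have : N₂ * N₂ = 0 := by linarith
      simpa using this
    subst hN2
    have : 0 ≤ N₃ := by nlinarith
    exact ⟨(0, √N₃), by simp [nullVec, Real.sq_sqrt this]⟩
  · refine ⟨(√N₁, N₂ / √N₁), ?_⟩
    have hs := Real.sqrt_pos.2 h0
    simp only [nullVec, Prod.mk.injEq]
    refine ⟨Real.sq_sqrt h0.le, by field_simp, ?_⟩
    rw [div_pow, Real.sq_sqrt h0.le]
    field_simp
    linarith

/-- Every ray of the hyperbolic plane is given by a spinor. -/
lemma exists_spinor_ray (c : GeodesicRay ℍ) : ∃ v, lor (vec (c.1 0)) (nullVec v) = 1 ∧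
    ∀ t, 0 ≤ t → vec (c.eval t) = Real.exp (-t) • vec (c.1 0) + Real.sinh t • nullVec v := by
  have d01 : dist (c.1 0) (c.eval 1) = 1 := by
    rw [← eval_zero, dist_eval c le_rfl zero_le_one]; norm_num
  obtain ⟨v, hv, hv'⟩ := exists_spinor (z := c.1 0) (z' := c.eval 1) (by
    rw [← dist_pos, d01]; exact one_pos)
  refine ⟨v, hv, fun t ht => ?_⟩
  obtain ⟨γ, hγ, hγv⟩ := exists_isometry_vec_eq hv
  have g0 : γ 0 = c.eval 0 := vec_injective (by rw [hγv]; simp)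
  have g1 : γ 1 = c.eval 1 := vec_injective (by rw [hγv, hv', d01])
  rw [← hγv]
  congr 1
  have hs1 : 0 < Real.sinh 1 := Real.sinh_pos_iff.2 one_pos
  have dc : ∀ s r : ℝ, 0 ≤ s → s ≤ r → dist (c.eval s) (c.eval r) = r - s := fun s r hs hr => by
    rw [dist_eval c hs (hs.trans hr), abs_sub_comm, abs_of_nonneg (by linarith)]
  have dg : ∀ s r : ℝ, s ≤ r → dist (γ s) (γ r) = r - s := fun s r hr => by
    rw [hγ.dist_eq, Real.dist_eq, abs_sub_comm, abs_of_nonneg (by linarith)]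
  apply eq_of_cosh_dist_le_one
  suffices h : ∀ z, Real.cosh (dist z (c.eval t)) = Real.cosh (dist z (γ t)) by
    rw [dist_comm, h]; simp
  intro z
  rcases le_total t 1 with h1 | h1
  · have k1 := stewart_upperHalfPlane z (c.eval 0) (c.eval 1) (c.eval t)
      (by rw [dc 0 t le_rfl ht, dc t 1 ht h1, dc 0 1 le_rfl zero_le_one]; ring)
    have k2 := stewart_upperHalfPlane z (γ 0) (γ 1) (γ t)
      (by rw [dg 0 t ht, dg t 1 h1, dg 0 1 zero_le_one]; ring)
    rw [dc 0 t le_rfl ht, dc t 1 ht h1, dc 0 1 le_rfl zero_le_one] at k1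
    rw [dg 0 t ht, dg t 1 h1, dg 0 1 zero_le_one, g0, g1] at k2
    rw [sub_zero] at k1 k2
    exact mul_right_cancel₀ hs1.ne' (k1.trans k2.symm)
  · have k1 := stewart_upperHalfPlane z (c.eval 0) (c.eval t) (c.eval 1)
      (by rw [dc 0 t le_rfl ht, dc 1 t zero_le_one h1, dc 0 1 le_rfl zero_le_one]; ring)
    have k2 := stewart_upperHalfPlane z (γ 0) (γ t) (γ 1)
      (by rw [dg 0 t ht, dg 1 t h1, dg 0 1 zero_le_one]; ring)
    rw [dc 0 t le_rfl ht, dc 1 t zero_le_one h1, dc 0 1 le_rfl zero_le_one] at k1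
    rw [dg 0 t ht, dg 1 t h1, dg 0 1 zero_le_one, g0, g1, k1] at k2
    rw [sub_zero] at k2
    exact mul_right_cancel₀ hs1.ne' (add_left_cancel k2)

lemma visual_sq_of_spinor {a b : GeodesicRay ℍ} {z : ℍ} (ha : a.1 0 = z) (hb : b.1 0 = z)
    {v w : ℝ × ℝ} (hv : lor (vec z) (nullVec v) = 1) (hw : lor (vec z) (nullVec w) = 1)
    (hav : ∀ t, 0 ≤ t → vec (a.eval t) = Real.exp (-t) • vec z + Real.sinh t • nullVec v)
    (hbw : ∀ t, 0 ≤ t → vec (b.eval t) = Real.exp (-t) • vec z + Real.sinh t • nullVec w) :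
    visual z a.endpoint b.endpoint ^ 2 = lor (nullVec v) (nullVec w) / 2 := by
  rw [isStewart_upperHalfPlane.visual_eq_lambdaLength ha hb]
  have h1 : Tendsto (fun t => (Real.cosh (dist (a.eval t) (b.eval t)) - 1) / Real.sinh t ^ 2) atTop
      (𝓝 (lor (nullVec v) (nullVec w))) := by
    refine tendsto_const_nhds.congr' ?_
    filter_upwards [eventually_gt_atTop 0] with t ht
    have hs : 0 < Real.sinh t := Real.sinh_pos_iff.2 ht
    rw [← lor_vec, hav t ht.le, hbw t ht.le]
    simp only [lor_add_left, lor_add_right, lor_smul_left, lor_smul_right, lor_vec_self, hw,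
      lor_comm (nullVec v) (vec z), hv]
    field_simp
    linear_combination -exp_neg_sq_add t
  have := tendsto_nhds_unique (tendsto_cosh_dist_div_sinh_sq a b) h1
  linarith

/-- Spinors for the points at infinity of the hyperbolic plane, seen from `z`. In them the visual
metric is half the absolute value of the symplectic form. -/
lemma exists_spinors (z : ℍ) : ∃ σ : Boundary ℍ → ℝ × ℝ,
    (∀ ξ, lor (vec z) (nullVec (σ ξ)) = 1) ∧
    (∀ ξ η, visual z ξ η = |wedge (σ ξ) (σ η)| / 2) ∧
    ∀ v, lor (vec z) (nullVec v) = 1 → ∃ ξ, nullVec (σ ξ) = nullVec v := by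
  choose c hc hcξ using fun ξ => isStewart_upperHalfPlane.exists_ray z ξ
  choose σ hσ hσ' using fun ξ => exists_spinor_ray (c ξ)
  simp only [hc] at hσ hσ'
  have hroot : ∀ {x : ℝ} {v w : ℝ × ℝ}, 0 ≤ x → x ^ 2 = lor (nullVec v) (nullVec w) / 2 →
      x = |wedge v w| / 2 := fun {x v w} hx h => by
    rw [lor_nullVec] at h
    rw [← abs_of_nonneg hx, ← abs_two (α := ℝ), ← abs_div, ← sq_eq_sq_iff_abs_eq_abs, h]; ring
  refine ⟨σ, hσ, fun ξ η => hroot (visual_nonneg _ _ _) ?_, fun v hv => ?_⟩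
  · conv_lhs => rw [← hcξ ξ, ← hcξ η]
    exact visual_sq_of_spinor (hc ξ) (hc η) (hσ ξ) (hσ η) (hσ' ξ) (hσ' η)
  · obtain ⟨γ, hγ, hγv⟩ := exists_isometry_vec_eq hv
    have hiso : Isometry fun t : ℝ≥0 => γ t := Isometry.of_dist_eq fun s t => by
      rw [hγ.dist_eq, NNReal.dist_eq, Real.dist_eq]
    let a : GeodesicRay ℍ := ⟨fun t => γ t, hiso⟩
    have ha : a.1 0 = z := vec_injective ((hγv _).trans (by simp))
    have hav : ∀ t, 0 ≤ t → vec (a.eval t) = Real.exp (-t) • vec z + Real.sinh t • nullVec v :=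
      fun t ht => by
        rw [← hγv]
        change vec (γ (t.toNNReal : ℝ)) = _
        rw [Real.coe_toNNReal t ht]
    refine ⟨a.endpoint, ?_⟩
    have hca : c a.endpoint = a :=
      isStewart_upperHalfPlane.eq_of_endpoint_eq ((hc _).trans ha.symm) (hcξ _)
    have h1 := hσ' a.endpoint 1 zero_le_one
    rw [hca, hav 1 zero_le_one] at h1
    exact (smul_right_injective _ (Real.sinh_pos_iff.2 one_pos).ne' (add_left_cancel h1)).symm

/-- Every point at infinity of the hyperbolic plane has an antipode as seen from `z`. -/
lemma exists_antipode (z : ℍ) (ξ : Boundary ℍ) : ∃ η, visual z ξ η = 1 ∧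
    ∀ ζ, visual z ξ ζ ^ 2 + visual z η ζ ^ 2 = 1 := by
  obtain ⟨σ, h1, h2, h3⟩ := exists_spinors z
  have hξ := h1 ξ
  have hζ := h1
  have hdet := lor_vec_self z
  generalize vec z = u at *
  obtain ⟨A, B, C⟩ := u
  set a := (σ ξ).1
  set b := (σ ξ).2
  have hξ' : A * b ^ 2 + C * a ^ 2 - 2 * (B * (a * b)) = 2 := by
    have : (A * b ^ 2 + C * a ^ 2) / 2 - B * (a * b) = 1 := hξ
    linarith
  have hdet' : A * C - B * B = 1 := by simp only [lor] at hdet; linarith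
  obtain ⟨η, hη⟩ := h3 (A * b - B * a, B * b - C * a) (by
    simp only [lor, nullVec]
    linear_combination (A * C - B * B) / 2 * hξ' + hdet')
  replace hη : ∀ ζ, visual z η ζ = |wedge (A * b - B * a, B * b - C * a) (σ ζ)| / 2 := fun ζ => by
    rw [h2, abs_wedge_congr hη]
  have hsum : ∀ ζ, visual z ξ ζ ^ 2 + visual z η ζ ^ 2 = 1 := fun ζ => by
    rw [h2 ξ ζ, hη ζ, div_pow, div_pow, sq_abs, sq_abs]
    have hz := hζ ζ
    simp only [lor, nullVec] at hz
    simp only [wedge]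
    set x := (σ ζ).1
    set y := (σ ζ).2
    have e1 : (A * b - B * a) ^ 2 = 2 * A - a ^ 2 := by
      linear_combination A * hξ' - a ^ 2 * hdet'
    have e2 : (B * b - C * a) ^ 2 = 2 * C - b ^ 2 := by
      linear_combination C * hξ' - b ^ 2 * hdet'
    have e3 : (A * b - B * a) * (B * b - C * a) = 2 * B - a * b := by
      linear_combination B * hξ' - a * b * hdet'
    linear_combination y ^ 2 / 4 * e1 + x ^ 2 / 4 * e2 - x * y / 2 * e3 + hz
  refine ⟨η, ?_, hsum⟩
  have := hsum ξ
  rw [visual_self, visual_comm z η ξ] at this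
  exact (pow_eq_one_iff_of_nonneg (visual_nonneg z ξ η) two_ne_zero).1 (by linarith)

/-- A line through the origin of a ray that ends at the endpoint of the ray contains the ray. -/
lemma visual_eval_eq_one {X : Type*} [MetricSpace X] [CompleteSpace X] (hX : IsStewart X)
    {c : GeodesicRay X} {η : Boundary X} (h : visual (c.1 0) c.endpoint η = 1) {t : ℝ}
    (ht : 0 ≤ t) : visual (c.eval t) c.endpoint η = 1 := by
  refine le_antisymm (visual_le_one _ _ _) ?_
  rw [visual_change (c.1 0), h, one_mul, Real.one_le_exp_iff, hX.cocycle_endpoint, busemann_zero,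
    busemann_eval c ht, cocycle_swap]
  have h1 := cocycle_le_dist η (c.eval t) (c.1 0)
  rw [← eval_zero, dist_eval c ht le_rfl, sub_zero, abs_of_nonneg ht, eval_zero] at h1
  linarith

/-- Two points of the hyperbolic plane lie on a line. -/
lemma exists_line_through {z z' : ℍ} (h : z ≠ z') :
    ∃ ξ η, visual z ξ η = 1 ∧ visual z' ξ η = 1 := by
  obtain ⟨v, hv, hv'⟩ := exists_spinor h
  obtain ⟨γ, hγ, hγv⟩ := exists_isometry_vec_eq hv
  have hiso : Isometry fun t : ℝ≥0 => γ t := Isometry.of_dist_eq fun s t => by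
    rw [hγ.dist_eq, NNReal.dist_eq, Real.dist_eq]
  let a : GeodesicRay ℍ := ⟨fun t => γ t, hiso⟩
  have ha : a.1 0 = z := vec_injective ((hγv _).trans (by simp))
  have ha' : a.eval (dist z z') = z' := vec_injective (by
    rw [hv', ← hγv]
    change vec (γ ((dist z z').toNNReal : ℝ)) = _
    rw [Real.coe_toNNReal _ dist_nonneg])
  obtain ⟨η, hη, -⟩ := exists_antipode z a.endpoint
  refine ⟨a.endpoint, η, hη, ?_⟩
  rw [← ha']
  exact visual_eval_eq_one isStewart_upperHalfPlane (by rwa [ha]) dist_nonneg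

/-- Ptolemy's theorem for ideal quadrilaterals of the hyperbolic plane. -/
lemma ptolemy_upperHalfPlane (z : ℍ) (a b c d : Boundary ℍ) :
    visual z a b * visual z c d = visual z a c * visual z b d + visual z a d * visual z b c ∨
    visual z a c * visual z b d = visual z a b * visual z c d + visual z a d * visual z b c ∨
    visual z a d * visual z b c = visual z a b * visual z c d + visual z a c * visual z b d := by
  obtain ⟨σ, -, h2, -⟩ := exists_spinors z
  simp only [h2]
  have key : wedge (σ a) (σ b) * wedge (σ c) (σ d) - wedge (σ a) (σ c) * wedge (σ b) (σ d) +
      wedge (σ a) (σ d) * wedge (σ b) (σ c) = 0 := by simp only [wedge]; ring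
  have e : ∀ x y : ℝ, |x| / 2 * (|y| / 2) = |x * y| / 4 := fun x y => by rw [abs_mul]; ring
  simp only [e]
  generalize wedge (σ a) (σ b) * wedge (σ c) (σ d) = x at *
  generalize wedge (σ a) (σ c) * wedge (σ b) (σ d) = y at *
  generalize wedge (σ a) (σ d) * wedge (σ b) (σ c) = w at *
  rcases abs_cases x with ⟨hx, hx'⟩ | ⟨hx, hx'⟩ <;> rcases abs_cases y with ⟨hy, hy'⟩ | ⟨hy, hy'⟩ <;>
    rcases abs_cases w with ⟨hw, hw'⟩ | ⟨hw, hw'⟩ <;> rw [hx, hy, hw] <;>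
    first
    | (left; linarith)
    | (right; left; linarith)
    | (right; right; linarith)

/-- Quadruples with one arbitrarily small cross ratio and another different from `1`. -/
lemma exists_quadruple {δ : ℝ} (hδ : 0 < δ) : ∃ (z : ℍ) (u v w x : Boundary ℍ),
    [u, v, w, x].Nodup ∧
    visual z u x * visual z w v / (visual z u v * visual z x w) < δ ∧
    visual z u v * visual z x w / (visual z u w * visual z v x) ≠ 1 := by
  obtain ⟨z, hz⟩ := exists_vec_eq (u := (1, 0, 1)) (by norm_num [lor]) (by norm_num)
  obtain ⟨σ, h1, h2, h3⟩ := exists_spinors z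
  have hz' : ∀ a b : ℝ, a ^ 2 + b ^ 2 = 2 → lor (vec z) (nullVec (a, b)) = 1 := fun a b h => by
    rw [hz]; simp only [lor, nullVec]; linarith
  have hv : ∀ {ξ η : Boundary ℍ} {a b : ℝ × ℝ}, nullVec (σ ξ) = nullVec a →
      nullVec (σ η) = nullVec b → visual z ξ η = |wedge a b| / 2 := fun hξ hη => by
    rw [h2, abs_wedge_congr hξ, abs_wedge_comm, abs_wedge_congr hη, abs_wedge_comm]
  have hs2 : √2 ^ 2 = (2 : ℝ) := Real.sq_sqrt two_pos.le
  have hs0 : 0 < √(2 : ℝ) := Real.sqrt_pos.2 two_pos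
  -- The slopes of the four spinors are `0`, `∞`, `1` and the small number `e`.
  set e : ℝ := δ / (2 + δ) with he
  have he0 : 0 < e := by positivity
  have he1 : 0 < 1 - e := by
    have : 1 - e = 2 / (2 + δ) := by rw [he]; field_simp; ring
    rw [this]; positivity
  set r : ℝ := √(2 / (1 + e ^ 2)) with hr
  have hr0 : 0 < r := Real.sqrt_pos.2 (by positivity)
  have hr2 : r ^ 2 * (1 + e ^ 2) = 2 := by
    rw [hr, Real.sq_sqrt (by positivity)]; field_simp
  obtain ⟨u, hu⟩ := h3 (√2, 0) (hz' _ _ (by simp))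
  obtain ⟨v, hv'⟩ := h3 (0, √2) (hz' _ _ (by simp))
  obtain ⟨w, hw⟩ := h3 (1, 1) (hz' _ _ (by norm_num))
  obtain ⟨x, hx⟩ := h3 (r, r * e) (hz' _ _ (by linarith))
  have e1 : visual z u x = √2 * (r * e) / 2 := by
    rw [hv hu hx]; simp only [wedge, zero_mul, sub_zero]; rw [abs_of_pos (by positivity)]
  have e2 : visual z v w = √2 / 2 := by
    rw [hv hv' hw]; simp only [wedge, mul_one, zero_sub, abs_neg]; rw [abs_of_pos hs0]
  have e3 : visual z u v = 1 := by
    rw [hv hu hv']; simp only [wedge, mul_zero, sub_zero]; rw [← sq, hs2]; norm_num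
  have e4 : visual z x w = r * (1 - e) / 2 := by
    rw [hv hx hw]; simp only [wedge, mul_one]
    rw [show r - r * e = r * (1 - e) by ring, abs_of_pos (by positivity)]
  have e5 : visual z u w = √2 / 2 := by
    rw [hv hu hw]; simp only [wedge, mul_one, sub_zero]; rw [abs_of_pos hs0]
  have e6 : visual z x v = r * √2 / 2 := by
    rw [hv hx hv']; simp only [wedge, mul_zero, sub_zero]; rw [abs_of_pos (by positivity)]
  have hne : ∀ {a b : Boundary ℍ}, 0 < visual z a b → a ≠ b := by
    rintro a _ h rfl; simp at h
  rw [visual_comm] at e2 e6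
  refine ⟨z, u, v, w, x, ?_, ?_, ?_⟩
  · have n1 := hne (a := u) (b := x) (by rw [e1]; positivity)
    have n2 := hne (a := w) (b := v) (by rw [e2]; positivity)
    have n3 := hne (a := u) (b := v) (by rw [e3]; positivity)
    have n4 := hne (a := x) (b := w) (by rw [e4]; positivity)
    have n5 := hne (a := u) (b := w) (by rw [e5]; positivity)
    have n6 := hne (a := v) (b := x) (by rw [e6]; positivity)
    simp [n1, n2.symm, n3, n4.symm, n5, n6]
  · rw [e1, e2, e3, e4, div_lt_iff₀ (by positivity)]
    have : √2 * (r * e) / 2 * (√2 / 2) = √2 ^ 2 * r * e / 4 := by ring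
    rw [this, hs2]
    have h6 : 1 - e = 2 / (2 + δ) := by rw [he]; field_simp; ring
    rw [h6, he]
    have : 0 < r * (δ / (2 + δ)) := by positivity
    have h7 : δ * (1 * (r * (2 / (2 + δ)) / 2)) = r * (δ / (2 + δ)) := by field_simp
    rw [h7]; linarith
  · rw [e3, e4, e5, e6]
    have : √2 / 2 * (r * √2 / 2) = √2 ^ 2 * r / 4 := by ring
    rw [this, hs2, Ne, div_eq_one_iff_eq (by positivity)]
    intro h
    have : r * e = 0 := by linarith
    exact absurd this (by positivity)

section Moebius

variable {X : Type*} [MetricSpace X]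

/-! ### Moebius maps of the circle extend to isometric embeddings -/

lemma exists_two_ne (ξ : Boundary ℍ) : ∃ b c, ξ ≠ b ∧ ξ ≠ c ∧ b ≠ c := by
  obtain ⟨-, u, v, w, x, h, -⟩ := exists_quadruple one_pos
  simp only [List.nodup_cons, List.mem_cons, not_or] at h
  obtain ⟨⟨h1, h2, -⟩, ⟨h3, -⟩, -⟩ := h
  by_cases hu : ξ = u
  · exact ⟨v, w, hu ▸ h1, hu ▸ h2, h3⟩
  by_cases hv : ξ = v
  · exact ⟨u, w, hu, hv ▸ h3, h2⟩
  · exact ⟨u, v, hu, hv, h1⟩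

/-- Cross ratios are preserved, written without quotients so that coincidences among the four
points are allowed. -/
lemma visual_mul_eq_of_crossRatio [CompleteSpace X] (hX : IsStewart X)
    {φ : Boundary ℍ → Boundary X} (hinj : Function.Injective φ)
    (hcr : ∀ ξ₀ η₀ ξ₁ η₁ : Boundary ℍ, [ξ₀, η₀, ξ₁, η₁].Nodup →
      crossRatio (φ ξ₀) (φ η₀) (φ ξ₁) (φ η₁) = crossRatio ξ₀ η₀ ξ₁ η₁)
    (z : ℍ) (q : X) (a b c d : Boundary ℍ) :
    visual q (φ a) (φ b) * visual q (φ c) (φ d) * (visual z a d * visual z b c) =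
      visual z a b * visual z c d * (visual q (φ a) (φ d) * visual q (φ b) (φ c)) := by
  rcases eq_or_ne a b with rfl | hab
  · simp
  rcases eq_or_ne c d with rfl | hcd
  · simp
  rcases eq_or_ne a d with rfl | had
  · simp
  rcases eq_or_ne b c with rfl | hbc
  · simp
  rcases eq_or_ne a c with rfl | hac
  · rw [visual_comm z b a, visual_comm q (φ b)]; ring
  rcases eq_or_ne b d with rfl | hbd
  · rw [visual_comm z b c, visual_comm q (φ b)]; ring
  have h := hcr a c b d (by simp [hac, hab, had, hbc.symm, hcd, hbd])
  rw [hX.crossRatio_eq q (hinj.ne had) (hinj.ne hbc),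
    isStewart_upperHalfPlane.crossRatio_eq z had hbc] at h
  have v1 := hX.visual_pos q (hinj.ne had)
  have v2 := hX.visual_pos q (hinj.ne hbc)
  have v3 := isStewart_upperHalfPlane.visual_pos z had
  have v4 := isStewart_upperHalfPlane.visual_pos z hbc
  rw [div_eq_div_iff (by positivity) (by positivity)] at h
  exact h

/-- Angles at a point `z` of the hyperbolic plane are realised at a point of `X`. On the line
joining the images of two antipodes `ξ`, `η` at `z` there is one point `q` at which the visual
metrics are conformal to each other; the conformal factor is at least `1` since angles in `X` are
at least those of comparison triangles, and equals `1` since visual metrics are at most `1`,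
and equal to `1` on antipodes. -/
lemma exists_visual_eq [CompleteSpace X] (hX : IsStewart X)
    {φ : Boundary ℍ → Boundary X} (hinj : Function.Injective φ)
    (hcr : ∀ ξ₀ η₀ ξ₁ η₁ : Boundary ℍ, [ξ₀, η₀, ξ₁, η₁].Nodup →
      crossRatio (φ ξ₀) (φ η₀) (φ ξ₁) (φ η₁) = crossRatio ξ₀ η₀ ξ₁ η₁) (z : ℍ) :
    ∃ q : X, ∀ ζ ζ', visual q (φ ζ) (φ ζ') = visual z ζ ζ' := by
  have hH := isStewart_upperHalfPlane
  obtain ⟨-, ξ, -⟩ := exists_quadruple one_pos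
  obtain ⟨η, hη, hanti⟩ := exists_antipode z ξ
  have hξη : ξ ≠ η := by rintro rfl; simp at hη
  obtain ⟨ω, hξω, hηω⟩ : ∃ ω, ξ ≠ ω ∧ η ≠ ω := by
    obtain ⟨b, c, hb, hc, hbc⟩ := exists_two_ne ξ
    by_cases h : η = b
    · exact ⟨c, hc, h ▸ hbc⟩
    · exact ⟨b, hb, h⟩
  have cr := visual_mul_eq_of_crossRatio hX hinj hcr z
  obtain ⟨o⟩ : Nonempty X := ⟨(φ ξ).ray.1 0⟩
  have w1 := hH.visual_pos z hξω
  have w2 := hH.visual_pos z hηω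
  have o1 := hX.visual_pos o (hinj.ne hξω)
  have o2 := hX.visual_pos o (hinj.ne hηω)
  obtain ⟨q, hq, hs⟩ := hX.exists_visual_eq_one (hinj.ne hξη) o
    (2 * Real.log ((visual o (φ η) (φ ω) * visual z ξ ω) / (visual o (φ ξ) (φ ω) * visual z η ω)))
  have hω : visual q (φ ξ) (φ ω) * visual z η ω = visual q (φ η) (φ ω) * visual z ξ ω := by
    rw [visual_change o q (φ ξ), visual_change o q (φ η)]
    have h1 : Real.exp ((cocycle (φ ξ) o q + cocycle (φ ω) o q) / 2) =
        (visual o (φ η) (φ ω) * visual z ξ ω) / (visual o (φ ξ) (φ ω) * visual z η ω) *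
        Real.exp ((cocycle (φ η) o q + cocycle (φ ω) o q) / 2) := by
      have hpos : 0 < (visual o (φ η) (φ ω) * visual z ξ ω) /
        (visual o (φ ξ) (φ ω) * visual z η ω) := by positivity
      conv_rhs => rw [← Real.exp_log hpos]
      rw [← Real.exp_add]
      congr 1; linarith
    rw [h1]; field_simp
  have q1 := hX.visual_pos q (hinj.ne hξω)
  have q2 := hX.visual_pos q (hinj.ne hηω)
  have hprop : ∀ ζ, visual q (φ ξ) (φ ζ) * visual z η ζ = visual q (φ η) (φ ζ) * visual z ξ ζ :=
    fun ζ => by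
    have h1 := cr q ξ ζ η ω
    rw [visual_comm z ζ η, visual_comm q (φ ζ) (φ η)] at h1
    have h2 : (visual q (φ ξ) (φ ζ) * visual z η ζ) * (visual q (φ η) (φ ω) * visual z ξ ω) =
        (visual q (φ η) (φ ζ) * visual z ξ ζ) * (visual q (φ ξ) (φ ω) * visual z η ω) := by
      linear_combination h1
    rw [hω] at h2
    exact mul_right_cancel₀ (by positivity) h2
  set lam : Boundary ℍ → ℝ := fun ζ => √(visual q (φ ξ) (φ ζ) ^ 2 + visual q (φ η) (φ ζ) ^ 2)
    with hlam
  have hlam2 : ∀ ζ, lam ζ ^ 2 = visual q (φ ξ) (φ ζ) ^ 2 + visual q (φ η) (φ ζ) ^ 2 :=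
    fun ζ => Real.sq_sqrt (by positivity)
  have hlam1 : ∀ ζ, 1 ≤ lam ζ := fun ζ =>
    Real.one_le_sqrt.2 (hX.one_le_visual_sq_add (hinj.ne hξη) hq (φ ζ))
  have hlam0 : ∀ ζ, 0 ≤ lam ζ := fun ζ => zero_le_one.trans (hlam1 ζ)
  have hξl : ∀ ζ, visual q (φ ξ) (φ ζ) = lam ζ * visual z ξ ζ := fun ζ => by
    refine (sq_eq_sq₀ (visual_nonneg _ _ _) (mul_nonneg (hlam0 ζ) (visual_nonneg _ _ _))).1 ?_
    rw [mul_pow, hlam2]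
    linear_combination (-visual q (φ ξ) (φ ζ) ^ 2) * hanti ζ + (visual q (φ ξ) (φ ζ) *
      visual z η ζ + visual q (φ η) (φ ζ) * visual z ξ ζ) * hprop ζ
  have hηl : ∀ ζ, visual q (φ η) (φ ζ) = lam ζ * visual z η ζ := fun ζ => by
    refine (sq_eq_sq₀ (visual_nonneg _ _ _) (mul_nonneg (hlam0 ζ) (visual_nonneg _ _ _))).1 ?_
    rw [mul_pow, hlam2]
    linear_combination (-visual q (φ η) (φ ζ) ^ 2) * hanti ζ - (visual q (φ ξ) (φ ζ) *
      visual z η ζ + visual q (φ η) (φ ζ) * visual z ξ ζ) * hprop ζ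
  have hlξ : lam ξ = 1 := by
    simp only [hlam, visual_self]; rw [visual_comm, hq]; norm_num
  have hlη : lam η = 1 := by
    simp only [hlam, visual_self]; rw [hq]; norm_num
  have hall : ∀ ζ ζ', visual q (φ ζ) (φ ζ') = lam ζ * lam ζ' * visual z ζ ζ' := fun ζ ζ' => by
    rcases eq_or_ne ζ η with rfl | h1
    · rw [hlη, hηl]; ring
    rcases eq_or_ne ζ' ξ with rfl | h2
    · rw [hlξ, visual_comm q, hξl, visual_comm z]; ring
    have h := cr q ζ ζ' ξ η
    rw [hq, hη, visual_comm q (φ ζ) (φ η), hηl, visual_comm q (φ ζ') (φ ξ), hξl,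
      visual_comm z η, visual_comm z ξ] at h
    have v1 := hH.visual_pos z h1
    have v2 := hH.visual_pos z h2
    refine mul_right_cancel₀ (mul_pos v1 v2).ne' ?_
    linear_combination h
  have hone : ∀ ζ, lam ζ = 1 := fun ζ => by
    obtain ⟨ζ', h', -⟩ := exists_antipode z ζ
    have h1 := visual_le_one q (φ ζ) (φ ζ')
    rw [hall, h', mul_one] at h1
    nlinarith [hlam1 ζ, hlam1 ζ']
  exact ⟨q, fun ζ ζ' => by rw [hall, hone, hone]; ring⟩

/-- Bourdon's theorem: a Moebius map from the boundary of the hyperbolic plane is induced by an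
isometric embedding. -/
theorem exists_isometry_of_moebius [CompleteSpace X] (hX : IsStewart X)
    {φ : Boundary ℍ → Boundary X} (hinj : Function.Injective φ)
    (hcr : ∀ ξ₀ η₀ ξ₁ η₁ : Boundary ℍ, [ξ₀, η₀, ξ₁, η₁].Nodup →
      crossRatio (φ ξ₀) (φ η₀) (φ ξ₁) (φ η₁) = crossRatio ξ₀ η₀ ξ₁ η₁) :
    ∃ (F : ℍ → X) (hF : Isometry F), φ = Boundary.map F hF := by
  have hH := isStewart_upperHalfPlane
  choose F hF using exists_visual_eq hX hinj hcr
  have hcoc : ∀ z z' ξ, cocycle (φ ξ) (F z) (F z') = cocycle ξ z z' := fun z z' ξ => by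
    have hsum : ∀ {a b : Boundary ℍ}, a ≠ b →
        cocycle (φ a) (F z) (F z') + cocycle (φ b) (F z) (F z') =
          cocycle a z z' + cocycle b z z' := fun {a b} hab => by
      have h1 := visual_change (F z) (F z') (φ a) (φ b)
      rw [hF, hF, visual_change z z'] at h1
      have h2 := Real.exp_injective (mul_left_cancel₀ (hH.visual_pos z hab).ne' h1)
      linarith
    obtain ⟨b, c, hb, hc, hbc⟩ := exists_two_ne ξ
    linarith [hsum hb, hsum hc, hsum hbc]
  have hiso : Isometry F := Isometry.of_dist_eq fun z z' => by
    rcases eq_or_ne z z' with rfl | hne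
    · simp
    obtain ⟨ξ, η, h1, h2⟩ := exists_line_through hne
    have hξη : ξ ≠ η := by rintro rfl; simp at h1
    rw [hH.dist_eq_abs_cocycle hξη h1 h2, hX.dist_eq_abs_cocycle (hinj.ne hξη)
      ((hF z ξ η).trans h1) ((hF z' ξ η).trans h2), hcoc]
  refine ⟨F, hiso, funext fun ξ => ?_⟩
  have h := hX.endpoint_eq_of_cocycle (c := ξ.ray.map F hiso) (ζ := φ ξ) fun t ht => by
    rw [eval_map]
    change cocycle (φ ξ) _ (F (ξ.ray.1 0)) = _
    rw [hcoc, cocycle, busemann_eval _ ht, busemann_zero, sub_zero]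
  rw [← h, ← map_endpoint, endpoint_ray]

/-! ### Asymptotically Moebius sequences -/

lemma tendsto_visual_div [CompleteSpace X] (hX : IsStewart X) {φ : ℕ → Boundary ℍ → Boundary X}
    (hφ : AsymptoticallyMoebius φ) (p : X) (z : ℍ) {a b c d : Boundary ℍ}
    (h : [a, b, c, d].Nodup) :
    Tendsto (fun k => visual p (φ k a) (φ k b) * visual p (φ k c) (φ k d) /
      (visual p (φ k a) (φ k d) * visual p (φ k b) (φ k c))) atTop
      (𝓝 (visual z a b * visual z c d / (visual z a d * visual z b c))) := by
  have hne : ∀ {Y : Type _} {a b c d : Y}, [a, b, c, d].Nodup →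
      [a, c, b, d].Nodup ∧ a ≠ d ∧ b ≠ c := fun h => by
    simp only [List.nodup_cons, List.mem_cons, not_or, List.not_mem_nil, not_false_eq_true,
      List.nodup_nil, and_true] at h ⊢
    tauto
  obtain ⟨h1, h2, h3⟩ := hne h
  obtain ⟨k1, k2⟩ := hφ a c b d h1
  rw [isStewart_upperHalfPlane.crossRatio_eq z h2 h3] at k2
  refine k2.congr' ?_
  filter_upwards [k1] with k hk
  have hk' : φ k a ≠ φ k d ∧ φ k b ≠ φ k c := by
    simp only [List.nodup_cons, List.mem_cons, not_or, List.not_mem_nil, not_false_eq_true,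
      List.nodup_nil, and_true] at hk
    tauto
  exact hX.crossRatio_eq p hk'.1 hk'.2

/-- If an asymptotically Moebius sequence into `∂X` exists and the isometry group is transitive on
triples, two sides of an ideal triangle do not meet. Otherwise any two sides of any ideal triangle
would meet at the same distance from the third side, as in a tree, and one of any three cross
ratios that are permuted by permutations of the four points would be exactly `1` as soon as
another one is small. -/
lemma visual_ne_one [CompleteSpace X] (hX : IsStewart X) (hG : TransitiveOnTriples X)
    {φ : ℕ → Boundary ℍ → Boundary X} (hφ : AsymptoticallyMoebius φ) {u v w : Boundary X}
    (h : [u, v, w].Nodup) {q : X} (huv : visual q u v = 1) : visual q u w ≠ 1 := by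
  intro huw
  have hvw : v ≠ w := by
    simp only [List.nodup_cons, List.mem_cons, not_or] at h; exact h.2.1.1
  set δ := visual q v w with hδ
  have hδ0 : 0 < δ := hX.visual_pos q hvw
  have htrip : ∀ u' v' w' : Boundary X, [u', v', w'].Nodup →
      ∃ q', visual q' u' v' = 1 ∧ visual q' u' w' = 1 ∧ visual q' v' w' = δ := by
    intro u' v' w' h'
    obtain ⟨g, rfl, rfl, rfl⟩ := hG u v w u' v' w' h h'
    refine ⟨g q, ?_⟩
    simp only [visual_map hX hX g.isometry]
    exact ⟨huv, huw, rfl⟩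
  obtain ⟨z, u₀, v₀, w₀, x₀, hn, hsmall, hneq⟩ := exists_quadruple (sq_pos_of_pos hδ0)
  have hn' : [u₀, x₀, w₀, v₀].Nodup ∧ [u₀, v₀, x₀, w₀].Nodup := by
    simp only [List.nodup_cons, List.mem_cons, not_or, List.not_mem_nil, not_false_eq_true,
      List.nodup_nil, and_true] at hn ⊢
    refine ⟨?_, ?_⟩ <;> tauto
  have t1 := tendsto_visual_div hX hφ q z hn'.1
  have t2 := tendsto_visual_div hX hφ q z hn'.2
  refine hneq (tendsto_nhds_unique t2 (tendsto_const_nhds.congr' ?_))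
  filter_upwards [t1.eventually_lt_const hsmall, (hφ u₀ v₀ w₀ x₀ hn).1] with k hk hnk
  generalize φ k u₀ = u at *
  generalize φ k v₀ = v at *
  generalize φ k w₀ = w at *
  generalize φ k x₀ = x at *
  simp only [List.nodup_cons, List.mem_cons, not_or, List.not_mem_nil, not_false_eq_true,
      List.nodup_nil, and_true] at hnk
  obtain ⟨⟨nuv, nuw, nux⟩, ⟨nvw, nvx⟩, nwx⟩ := hnk
  -- Cross ratios do not depend on the point at which the visual metric is taken.
  have hbase : ∀ p a b c d, a ≠ d → b ≠ c →
      visual q a b * visual q c d / (visual q a d * visual q b c) =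
      visual p a b * visual p c d / (visual p a d * visual p b c) := fun p a b c d h1 h2 => by
    rw [← hX.crossRatio_eq q h1 h2, hX.crossRatio_eq p h1 h2]
  obtain ⟨p, p1, p2, p3⟩ := htrip u v w (by simp [nuv, nuw, nvw])
  have hux : visual p u x < δ := by
    rw [hbase p u x w v nuv (Ne.symm nwx), visual_comm p w v, p1, p3, one_mul,
      div_lt_iff₀ (hX.visual_pos p (Ne.symm nwx))] at hk
    have h1 := visual_le_one p x w
    have : visual p u x * δ < δ * δ := by nlinarith [sq_nonneg δ]
    exact lt_of_mul_lt_mul_right this hδ0.le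
  -- The side from `x` to `y` passes through `p`, as the one from `u` to `y` does.
  have hside : ∀ y, y ≠ u → y ≠ x → visual p u y = 1 → visual p x y = 1 := by
    intro y hyu hyx hy
    obtain ⟨p', c1, c2, c3⟩ := htrip y u x (by simp [hyu, hyx, nux])
    have hd := hX.dist_eq_abs_cocycle hyu c1 ((visual_comm _ _ _).trans hy)
    rcases le_total 0 (cocycle y p' p) with h0 | h0
    · refine le_antisymm (visual_le_one _ _ _) ?_
      rw [visual_change p', visual_comm p', c2, one_mul, Real.one_le_exp_iff]
      rw [abs_of_nonneg h0] at hd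
      have := cocycle_le_dist x p p'
      rw [cocycle_swap, dist_comm] at this
      linarith
    · exfalso
      rw [abs_of_nonpos h0] at hd
      have h1 := visual_change p' p y u
      rw [c1, visual_comm p y u, hy, one_mul, eq_comm, Real.exp_eq_one_iff] at h1
      have h2 := visual_change p' p u x
      rw [c3] at h2
      have h3 := cocycle_le_dist x p p'
      rw [cocycle_swap, dist_comm] at h3
      have h4 : 1 ≤ Real.exp ((cocycle u p' p + cocycle x p' p) / 2) :=
        Real.one_le_exp_iff.2 (by linarith)
      nlinarith
  rw [hbase p u v x w nuw nvx, p1, p2, hside w (Ne.symm nuw) nwx p2, visual_comm p v x,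
    hside v (Ne.symm nuv) nvx p1]
  norm_num

/-- The sides of all ideal triangles are uniformly separated. -/
lemma exists_visual_lt_of_transitive [CompleteSpace X] (hX : IsStewart X)
    (hG : TransitiveOnTriples X) {φ : ℕ → Boundary ℍ → Boundary X} (hφ : AsymptoticallyMoebius φ)
    {u₀ v₀ w₀ : Boundary X} (h₀ : [u₀, v₀, w₀].Nodup) {δ : ℝ} (hδ : 0 < δ) :
    ∃ ε > 0, ∀ (u v w : Boundary X) (q : X), [u, v, w].Nodup → 1 - ε < visual q u v →
      1 - ε < visual q u w → visual q v w < δ := by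
  have h₀' := h₀
  simp only [List.nodup_cons, List.mem_cons, not_or, List.not_mem_nil, not_false_eq_true,
    List.nodup_nil, and_true] at h₀'
  obtain ⟨ε, hε, H⟩ := hX.exists_visual_lt h₀'.1.1 h₀'.1.2 h₀'.2
    (fun q hq => visual_ne_one hX hG hφ h₀ hq) hδ
  refine ⟨ε, hε, fun u v w q h h1 h2 => ?_⟩
  obtain ⟨g, rfl, rfl, rfl⟩ := hG u₀ v₀ w₀ u v w h₀ h
  obtain ⟨q, rfl⟩ := g.surjective q
  rw [visual_map hX hX g.isometry] at h1 h2 ⊢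
  exact H q h1 h2

/-- The images of a point `ξ` form a Cauchy sequence if those of `w₁`, `w₂`, `w₃` are constant and
`w₁ w₂` and `w₃ ξ` are the diagonals of an ideal quadrilateral. In the limit the two diagonals of
the image meet at a fixed point `p` of the line from `a₁` to `a₂`, so that images of `ξ` are seen
from `p` almost opposite to `a₃`; they are close to each other as sides of ideal triangles issuing
from `a₃` are separated. -/
lemma tendsto_visual_zero_of_ptolemy [CompleteSpace X] (hX : IsStewart X)
    (hG : TransitiveOnTriples X) {φ : ℕ → Boundary ℍ → Boundary X} (hφ : AsymptoticallyMoebius φ)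
    {w₁ w₂ w₃ ξ : Boundary ℍ} {a₁ a₂ a₃ : Boundary X} (hw : [w₁, w₂, w₃, ξ].Nodup)
    (ha : [a₁, a₂, a₃].Nodup) (h₁ : ∀ᶠ k in atTop, φ k w₁ = a₁)
    (h₂ : ∀ᶠ k in atTop, φ k w₂ = a₂) (h₃ : ∀ᶠ k in atTop, φ k w₃ = a₃) (z : ℍ)
    (hpt : visual z w₁ w₂ * visual z w₃ ξ =
      visual z w₁ w₃ * visual z w₂ ξ + visual z w₁ ξ * visual z w₂ w₃) (o : X) :
    Tendsto (fun n : ℕ × ℕ => visual o (φ n.1 ξ) (φ n.2 ξ)) atTop (𝓝 0) := by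
  have hH := isStewart_upperHalfPlane
  have hw' := hw
  have ha' := ha
  simp only [List.nodup_cons, List.mem_cons, not_or, List.not_mem_nil, not_false_eq_true,
    List.nodup_nil, and_true] at hw' ha'
  obtain ⟨⟨n12, n13, n1⟩, ⟨n23, n2⟩, n3⟩ := hw'
  obtain ⟨⟨m12, m13⟩, m23⟩ := ha'
  have V12 := hH.visual_pos z n12
  have V13 := hH.visual_pos z n13
  have V23 := hH.visual_pos z n23
  have V1 := hH.visual_pos z n1
  have V2 := hH.visual_pos z n2
  have V3 := hH.visual_pos z n3
  have o13 := hX.visual_pos o m13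
  have o23 := hX.visual_pos o m23
  set R := visual z w₁ ξ * visual z w₂ w₃ / (visual z w₁ w₃ * visual z ξ w₂) with hR
  have hR0 : 0 < R := by rw [hR, visual_comm z ξ]; positivity
  obtain ⟨p, hp, hs⟩ := hX.exists_visual_eq_one m12 o
    (Real.log (visual o a₂ a₃ ^ 2 / (visual o a₁ a₃ ^ 2 * R)))
  have α₁0 := hX.visual_pos p m13
  have α₂0 := hX.visual_pos p m23
  have hα : R * visual p a₁ a₃ ^ 2 / visual p a₂ a₃ ^ 2 = 1 := by
    have e : ∀ a b : Boundary X, visual p a b ^ 2 =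
        visual o a b ^ 2 * (Real.exp (cocycle a o p) * Real.exp (cocycle b o p)) := fun a b => by
      rw [visual_change o p, mul_pow, ← Real.exp_nat_mul, ← Real.exp_add]
      congr 2; push_cast; ring
    have h1 : Real.exp (cocycle a₁ o p) = visual o a₂ a₃ ^ 2 / (visual o a₁ a₃ ^ 2 * R) *
        Real.exp (cocycle a₂ o p) := by
      have hpos : 0 < visual o a₂ a₃ ^ 2 / (visual o a₁ a₃ ^ 2 * R) := by positivity
      conv_rhs => rw [← Real.exp_log hpos]
      rw [← Real.exp_add]; congr 1; linarith
    rw [e, e, h1]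
    have := Real.exp_pos (cocycle a₂ o p)
    have := Real.exp_pos (cocycle a₃ o p)
    field_simp
  set x : ℕ → Boundary X := fun k => φ k ξ with hx
  -- From some index on the four image points are distinct and the first three are fixed.
  have hev : ∀ᶠ k in atTop, (a₁ ≠ x k ∧ a₂ ≠ x k ∧ a₃ ≠ x k) ∧
      φ k w₁ = a₁ ∧ φ k w₂ = a₂ ∧ φ k w₃ = a₃ := by
    filter_upwards [(hφ w₁ w₂ w₃ ξ hw).1, h₁, h₂, h₃] with k h0 e1 e2 e3
    simp only [List.nodup_cons, List.mem_cons, not_or, List.not_mem_nil, not_false_eq_true,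
      List.nodup_nil, and_true, e1, e2, e3] at h0
    exact ⟨⟨h0.1.2.2, h0.2.1.2, h0.2.2⟩, e1, e2, e3⟩
  -- `p` is the limit position of the intersection of the diagonals.
  have c1 := tendsto_visual_div hX hφ p z (a := w₁) (b := ξ) (c := w₂) (d := w₃)
    (by simp [n12, n13, n1, n23, Ne.symm n2, Ne.symm n3])
  have c2 := tendsto_visual_div hX hφ p z (a := w₁) (b := w₃) (c := ξ) (d := w₂)
    (by simp [n12, n13, n1, Ne.symm n23, Ne.symm n2, n3])
  have c3 := tendsto_visual_div hX hφ p z (a := w₁) (b := ξ) (c := w₃) (d := w₂)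
    (by simp [n12, n13, n1, Ne.symm n23, Ne.symm n2, Ne.symm n3])
  have hsum : visual z w₁ w₃ * visual z ξ w₂ / (visual z w₁ w₂ * visual z w₃ ξ) +
      visual z w₁ ξ * visual z w₃ w₂ / (visual z w₁ w₂ * visual z ξ w₃) = 1 := by
    rw [visual_comm z ξ w₂, visual_comm z ξ w₃, visual_comm z w₃ w₂, ← add_div, ← hpt]
    exact div_self (by positivity)
  have c4 := c2.add c3
  rw [hsum] at c4
  have d1 : Tendsto (fun k => visual p a₁ a₃ * visual p a₁ (x k) -
      visual p a₂ a₃ * visual p a₂ (x k)) atTop (𝓝 0) := by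
    have h1 := ((c1.mul_const (visual p a₁ a₃ ^ 2)).div_const (visual p a₂ a₃ ^ 2)).sub_const 1
    rw [← hR, hα, sub_self] at h1
    refine squeeze_zero_norm' ?_ (tendsto_zero_iff_norm_tendsto_zero.1 h1)
    filter_upwards [hev] with k ⟨⟨k1, k2, k3⟩, e1, e2, e3⟩
    rw [e1, e2, e3]
    change _ ≤ ‖visual p a₁ (x k) * visual p a₂ a₃ / (visual p a₁ a₃ * visual p (x k) a₂) *
      visual p a₁ a₃ ^ 2 / visual p a₂ a₃ ^ 2 - 1‖
    rw [visual_comm p (x k) a₂]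
    have b1 := hX.visual_pos p k2
    have e : visual p a₁ a₃ * visual p a₁ (x k) - visual p a₂ a₃ * visual p a₂ (x k) =
        (visual p a₂ a₃ * visual p a₂ (x k)) * (visual p a₁ (x k) * visual p a₂ a₃ /
        (visual p a₁ a₃ * visual p a₂ (x k)) * visual p a₁ a₃ ^ 2 / visual p a₂ a₃ ^ 2 - 1) := by
      field_simp
    rw [e, norm_mul]
    refine mul_le_of_le_one_left (norm_nonneg _) ?_
    rw [Real.norm_of_nonneg (by positivity)]
    exact mul_le_one₀ (visual_le_one _ _ _) b1.le (visual_le_one _ _ _)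
  -- Hence `p` is close to the diagonal from `a₃` to `x k`.
  have d2 : Tendsto (fun k => visual p a₃ (x k)) atTop (𝓝 1) := by
    have h1 := (((d1.pow 2).const_sub 1).div (c4.pow 2) (by norm_num))
    have h2 := (Real.continuous_sqrt.tendsto _).comp h1
    have e : √((1 - (0 : ℝ) ^ 2) / 1 ^ 2) = 1 := by norm_num
    rw [e] at h2
    refine tendsto_of_tendsto_of_tendsto_of_le_of_le' h2 tendsto_const_nhds ?_
      (Eventually.of_forall fun k => visual_le_one _ _ _)
    filter_upwards [hev] with k ⟨⟨k1, k2, k3⟩, e1, e2, e3⟩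
    simp only [Function.comp_apply, Pi.div_apply]
    rw [e1, e2, e3]
    change √((1 - _) / (visual p a₁ a₃ * visual p (x k) a₂ / (visual p a₁ a₂ * visual p a₃ (x k)) +
      visual p a₁ (x k) * visual p a₃ a₂ / (visual p a₁ a₂ * visual p (x k) a₃)) ^ 2) ≤ _
    rw [hp, visual_comm p (x k) a₂, visual_comm p (x k) a₃, visual_comm p a₃ a₂, one_mul, ← add_div]
    have b1 := hX.visual_pos p k1
    have b2 := hX.visual_pos p k2
    have b3 := hX.visual_pos p k3
    refine Real.sqrt_le_iff.2 ⟨b3.le, ?_⟩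
    rw [div_le_iff₀ (by positivity), div_pow, mul_div_cancel₀ _ (by positivity)]
    have s1 := hX.one_le_visual_sq_add m12 hp a₃
    have s2 := hX.one_le_visual_sq_add m12 hp (x k)
    nlinarith [mul_nonneg (sub_nonneg.2 s1) (sub_nonneg.2 s2)]
  have d3 : Tendsto (fun n : ℕ × ℕ => visual p (x n.1) (x n.2)) atTop (𝓝 0) := by
    rw [Metric.tendsto_nhds]
    intro δ hδ
    obtain ⟨ε, hε, H⟩ := exists_visual_lt_of_transitive hX hG hφ ha hδ
    have hN : ∀ᶠ k in atTop, 1 - ε < visual p a₃ (x k) ∧ a₃ ≠ x k :=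
      (d2.eventually_const_lt (by linarith)).and (hev.mono fun k hk => hk.1.2.2)
    rw [← prod_atTop_atTop_eq]
    filter_upwards [hN.prod_mk hN] with n hn
    rw [Real.dist_eq, sub_zero, abs_of_nonneg (visual_nonneg _ _ _)]
    rcases eq_or_ne (x n.1) (x n.2) with heq | hne
    · rw [heq, visual_self]; exact hδ
    · exact H a₃ _ _ p (by simp [hn.1.2, hn.2.2, hne]) hn.1.1 hn.2.1
  refine squeeze_zero (fun _ => visual_nonneg _ _ _)
    (fun n => visual_le_mul_exp_dist p o _ _) ?_
  simpa using d3.mul_const (Real.exp (dist p o))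

/-- An asymptotically Moebius sequence that fixes a triple is Cauchy at each point. -/
lemma tendsto_visual_zero [CompleteSpace X] (hX : IsStewart X)
    (hG : TransitiveOnTriples X) {φ : ℕ → Boundary ℍ → Boundary X} (hφ : AsymptoticallyMoebius φ)
    {w₁ w₂ w₃ : Boundary ℍ} {a₁ a₂ a₃ : Boundary X} (hw : [w₁, w₂, w₃].Nodup)
    (ha : [a₁, a₂, a₃].Nodup) (h₁ : ∀ᶠ k in atTop, φ k w₁ = a₁)
    (h₂ : ∀ᶠ k in atTop, φ k w₂ = a₂) (h₃ : ∀ᶠ k in atTop, φ k w₃ = a₃) (o : X)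
    (ξ : Boundary ℍ) :
    Tendsto (fun n : ℕ × ℕ => visual o (φ n.1 ξ) (φ n.2 ξ)) atTop (𝓝 0) := by
  have hconst : ∀ a : Boundary X, (∀ᶠ k in atTop, φ k ξ = a) →
      Tendsto (fun n : ℕ × ℕ => visual o (φ n.1 ξ) (φ n.2 ξ)) atTop (𝓝 0) := fun a h => by
    refine tendsto_const_nhds.congr' ?_
    rw [← prod_atTop_atTop_eq]
    filter_upwards [h.prod_mk h] with n hn
    rw [hn.1, hn.2, visual_self]
  by_cases e1 : ξ = w₁
  · exact hconst a₁ (e1 ▸ h₁)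
  by_cases e2 : ξ = w₂
  · exact hconst a₂ (e2 ▸ h₂)
  by_cases e3 : ξ = w₃
  · exact hconst a₃ (e3 ▸ h₃)
  simp only [List.nodup_cons, List.mem_cons, not_or, List.not_mem_nil, not_false_eq_true,
    List.nodup_nil, and_true] at hw ha
  obtain ⟨⟨n12, n13⟩, n23⟩ := hw
  obtain ⟨⟨m12, m13⟩, m23⟩ := ha
  obtain ⟨z, -⟩ := exists_quadruple one_pos
  rcases ptolemy_upperHalfPlane z w₁ w₂ w₃ ξ with h | h | h
  · exact tendsto_visual_zero_of_ptolemy hX hG hφ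
      (by simp [n12, n13, n23, Ne.symm e1, Ne.symm e2, Ne.symm e3])
      (by simp [m12, m13, m23]) h₁ h₂ h₃ z h o
  · refine tendsto_visual_zero_of_ptolemy hX hG hφ (w₁ := w₁) (w₂ := w₃) (w₃ := w₂)
      (by simp [n12, n13, Ne.symm n23, Ne.symm e1, Ne.symm e2, Ne.symm e3])
      (by simp [m12, m13, Ne.symm m23]) h₁ h₃ h₂ z ?_ o
    rw [h, visual_comm z w₃ w₂]
  · refine tendsto_visual_zero_of_ptolemy hX hG hφ (w₁ := w₂) (w₂ := w₃) (w₃ := w₁)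
      (by simp [Ne.symm n12, Ne.symm n13, n23, Ne.symm e1, Ne.symm e2, Ne.symm e3])
      (by simp [Ne.symm m12, Ne.symm m13, m23]) h₂ h₃ h₁ z ?_ o
    rw [mul_comm, h, visual_comm z w₂ w₁, visual_comm z w₃ w₁]; ring

/-- Pointwise limits of asymptotically Moebius sequences that fix a triple are injective: if two
points had the same image, a cross ratio would vanish in the limit. -/
lemma injective_of_tendsto [CompleteSpace X] (hX : IsStewart X)
    {φ : ℕ → Boundary ℍ → Boundary X} (hφ : AsymptoticallyMoebius φ)
    {w₁ w₂ w₃ : Boundary ℍ} {a₁ a₂ a₃ : Boundary X}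
    (ha : [a₁, a₂, a₃].Nodup) (h₁ : ∀ᶠ k in atTop, φ k w₁ = a₁)
    (h₂ : ∀ᶠ k in atTop, φ k w₂ = a₂) (h₃ : ∀ᶠ k in atTop, φ k w₃ = a₃) {o : X}
    {ψ : Boundary ℍ → Boundary X}
    (hψ : ∀ ξ, Tendsto (fun k => visual o (φ k ξ) (ψ ξ)) atTop (𝓝 0)) :
    Function.Injective ψ := by
  have hfix : ∀ {w a}, (∀ᶠ k in atTop, φ k w = a) → ψ w = a := fun {w a} h => by
    by_contra hne
    refine (hX.visual_pos o (Ne.symm hne)).ne' (tendsto_nhds_unique ?_ (hψ w))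
    refine tendsto_const_nhds.congr' ?_
    filter_upwards [h] with k hk
    rw [hk]
  have e1 := hfix h₁
  have e2 := hfix h₂
  have e3 := hfix h₃
  simp only [List.nodup_cons, List.mem_cons, not_or, List.not_mem_nil, not_false_eq_true,
    List.nodup_nil, and_true] at ha
  obtain ⟨⟨m12, m13⟩, m23⟩ := ha
  intro ξ η hξη
  by_contra hne
  obtain ⟨c, d, hc, hd, hcd⟩ : ∃ c d, ψ ξ ≠ ψ c ∧ ψ ξ ≠ ψ d ∧ ψ c ≠ ψ d := by
    by_cases k1 : ψ ξ = a₁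
    · exact ⟨w₂, w₃, by rwa [k1, e2], by rwa [k1, e3], by rwa [e2, e3]⟩
    by_cases k2 : ψ ξ = a₂
    · exact ⟨w₁, w₃, by rwa [e1], by rwa [k2, e3], by rwa [e1, e3]⟩
    · exact ⟨w₁, w₂, by rwa [e1], by rwa [e2], by rwa [e1, e2]⟩
  have n1 : ξ ≠ c := fun h => hc (by rw [h])
  have n2 : ξ ≠ d := fun h => hd (by rw [h])
  have n3 : η ≠ c := fun h => hc (by rw [hξη, h])
  have n4 : η ≠ d := fun h => hd (by rw [hξη, h])
  have n5 : c ≠ d := fun h => hcd (by rw [h])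
  obtain ⟨z, -⟩ := exists_quadruple one_pos
  have t1 := tendsto_visual_div hX hφ o z (a := ξ) (b := η) (c := c) (d := d)
    (by simp [hne, n1, n2, n3, n4, n5])
  have t2 := ((hX.tendsto_visual o (hψ ξ) (hψ η)).mul (hX.tendsto_visual o (hψ c) (hψ d))).div
    ((hX.tendsto_visual o (hψ ξ) (hψ d)).mul (hX.tendsto_visual o (hψ η) (hψ c)))
    (mul_pos (hX.visual_pos o hd) (hX.visual_pos o (hξη ▸ hc))).ne'
  have h := tendsto_nhds_unique t1 t2
  rw [hξη, visual_self, zero_mul, zero_div] at h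
  have hH := isStewart_upperHalfPlane
  have := hH.visual_pos z hne
  have := hH.visual_pos z n2
  have := hH.visual_pos z n3
  have := hH.visual_pos z n5
  exact absurd h (by positivity)

lemma crossRatio_eq_of_tendsto [CompleteSpace X] (hX : IsStewart X)
    {φ : ℕ → Boundary ℍ → Boundary X} (hφ : AsymptoticallyMoebius φ) {o : X}
    {ψ : Boundary ℍ → Boundary X} (hinj : Function.Injective ψ)
    (hψ : ∀ ξ, Tendsto (fun k => visual o (φ k ξ) (ψ ξ)) atTop (𝓝 0))
    (ξ₀ η₀ ξ₁ η₁ : Boundary ℍ) (h : [ξ₀, η₀, ξ₁, η₁].Nodup) :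
    crossRatio (ψ ξ₀) (ψ η₀) (ψ ξ₁) (ψ η₁) = crossRatio ξ₀ η₀ ξ₁ η₁ := by
  have hperm : [ξ₀, ξ₁, η₀, η₁].Nodup ∧ ξ₀ ≠ η₁ ∧ ξ₁ ≠ η₀ := by
    simp only [List.nodup_cons, List.mem_cons, not_or, List.not_mem_nil, not_false_eq_true,
      List.nodup_nil, and_true] at h ⊢
    tauto
  obtain ⟨hn, h1, h2⟩ := hperm
  obtain ⟨z, -⟩ := exists_quadruple one_pos
  rw [hX.crossRatio_eq o (hinj.ne h1) (hinj.ne h2), isStewart_upperHalfPlane.crossRatio_eq z h1 h2]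
  refine tendsto_nhds_unique ?_ (tendsto_visual_div hX hφ o z hn)
  exact ((hX.tendsto_visual o (hψ ξ₀) (hψ ξ₁)).mul (hX.tendsto_visual o (hψ η₀) (hψ η₁))).div
    ((hX.tendsto_visual o (hψ ξ₀) (hψ η₁)).mul (hX.tendsto_visual o (hψ ξ₁) (hψ η₀)))
    (mul_pos (hX.visual_pos o (hinj.ne h1)) (hX.visual_pos o (hinj.ne h2))).ne'

lemma map_injective [CompleteSpace X] (hX : IsStewart X) (g : X ≃ᵢ X) :
    Function.Injective (Boundary.map g g.isometry) := fun ξ η h => by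
  by_contra hne
  have := hX.visual_pos (ξ.ray.1 0) hne
  rw [← visual_map hX hX g.isometry, h, visual_self] at this
  exact lt_irrefl _ this

lemma asymptoticallyMoebius_map [CompleteSpace X] (hX : IsStewart X)
    {φ : ℕ → Boundary ℍ → Boundary X} (hφ : AsymptoticallyMoebius φ) (g : ℕ → X ≃ᵢ X) :
    AsymptoticallyMoebius fun k ξ => Boundary.map (g k) (g k).isometry (φ k ξ) := by
  intro ξ₀ η₀ ξ₁ η₁ h
  obtain ⟨h1, h2⟩ := hφ ξ₀ η₀ ξ₁ η₁ h
  refine ⟨h1.mono fun k hk => hk.map (map_injective hX (g k)), h2.congr' ?_⟩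
  filter_upwards [h1] with k hk
  have hk' : φ k ξ₀ ≠ φ k η₁ ∧ φ k ξ₁ ≠ φ k η₀ := by
    simp only [List.nodup_cons, List.mem_cons, not_or, List.not_mem_nil, not_false_eq_true,
      List.nodup_nil, and_true] at hk
    exact ⟨hk.1.2.2, Ne.symm hk.2.1.1⟩
  have hinj := map_injective hX (g k)
  let p := (φ k ξ₀).ray.1 0
  rw [hX.crossRatio_eq p hk'.1 hk'.2,
    hX.crossRatio_eq (g k p) (hinj.ne hk'.1) (hinj.ne hk'.2)]
  simp only [visual_map hX hX]

end Moebius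

end CATNegOne

open CATNegOne in
theorem theorem1 {X : Type*} [MetricSpace X] [CompleteSpace X] (hX : IsCATNegOne X)
    (hG : TransitiveOnTriples X) (p : ℍ) (o : X)
    (φ : ℕ → Boundary ℍ → Boundary X)
    (hcont : ∀ k, Continuous[coneTopology p, coneTopology o] (φ k))
    (hφ : AsymptoticallyMoebius φ) :
    ∃ (g : ℕ → X ≃ᵢ X) (φinf : Boundary ℍ → Boundary X),
      (∀ ξ : Boundary ℍ,
        Tendsto (fun k => Boundary.map (g k) (g k).isometry (φ k ξ)) atTop
          (@nhds (Boundary X) (coneTopology o) (φinf ξ))) ∧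
      ∃ (F : ℍ → X) (hF : Isometry F), φinf = Boundary.map F hF := by
  have hS := hX.isStewart
  obtain ⟨-, u, v, w, x, hn, -⟩ := exists_quadruple one_pos
  have hev : ∀ᶠ k in atTop, [φ k u, φ k v, φ k w].Nodup :=
    (hφ u v w x hn).1.mono fun k hk => hk.sublist (List.prefix_append [_, _, _] [_]).sublist
  have hn' : [u, v, w].Nodup := hn.sublist (List.prefix_append [u, v, w] [x]).sublist
  obtain ⟨K, hK⟩ := hev.exists
  -- Normalise the sequence on the triple `u`, `v`, `w`.
  have hg : ∀ k, ∃ g : X ≃ᵢ X, [φ k u, φ k v, φ k w].Nodup →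
      Boundary.map g g.isometry (φ k u) = φ K u ∧ Boundary.map g g.isometry (φ k v) = φ K v ∧
        Boundary.map g g.isometry (φ k w) = φ K w := fun k => by
    by_cases hk : [φ k u, φ k v, φ k w].Nodup
    · obtain ⟨g, hg⟩ := hG _ _ _ _ _ _ hk hK
      exact ⟨g, fun _ => hg⟩
    · exact ⟨IsometryEquiv.refl X, fun h => absurd h hk⟩
  choose g hg using hg
  set ψ : ℕ → Boundary ℍ → Boundary X :=
    fun k ξ => Boundary.map (g k) (g k).isometry (φ k ξ)
  have hψ : AsymptoticallyMoebius ψ := asymptoticallyMoebius_map hS hφ g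
  have h₁ : ∀ᶠ k in atTop, ψ k u = φ K u := hev.mono fun k hk => (hg k hk).1
  have h₂ : ∀ᶠ k in atTop, ψ k v = φ K v := hev.mono fun k hk => (hg k hk).2.1
  have h₃ : ∀ᶠ k in atTop, ψ k w = φ K w := hev.mono fun k hk => (hg k hk).2.2
  have hex : ∀ ξ, ∃ y, Tendsto (fun k => visual o (ψ k ξ) y) atTop (𝓝 0) := fun ξ =>
    hS.exists_tendsto_visual o (x := fun k => ψ k ξ)
      (tendsto_visual_zero hS hG hψ hn' hK h₁ h₂ h₃ o ξ)
  choose φinf hlim using hex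
  have hinj := injective_of_tendsto hS hψ hK h₁ h₂ h₃ hlim
  exact ⟨g, φinf, fun ξ => hS.tendsto_cone o (hlim ξ),
    exists_isometry_of_moebius hS hinj (crossRatio_eq_of_tendsto hS hψ hinj hlim)⟩
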